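/- Let $d,n_1,\dots,n_d\ge 0$ and $r_0,\dots,r_d\ge 0$ be integers with $r_0=r_d=1$. For $\bar{\mathcal X}=(\mathcal X^1,\dots,\mathcal X^d)$ with core tensors $\mathcal X^k\in\mathbb R^{r_{k-1}\times n_k\times r_k}$, let $\mathcal X^k(i)\in\mathbb R^{r_{k-1}\times r_k}$ be the $i$-th slice and let $\phi(\bar{\mathcal X})\in\mathbb R^{n_1\times\cdots\times n_d}$ be the tensor with entries $\phi(\bar{\mathcal X})(i_1,\dots,i_d)=\mathcal X^1(i_1)\cdots\mathcal X^d(i_d)$. Let $L(\mathcal X^k)\in\mathbb R^{r_{k-1}n_k\times r_k}$, with $L(\mathcal X^k)(a+r_{k-1}(i-1),b)=\mathcal X^k(a,i,b)$, and $R(\mathcal X^k)\in\mathbb R^{r_{k-1}\times n_kr_k}$, with $R(\mathcal X^k)(a,i+n_k(b-1))=\mathcal X^k(a,i,b)$, be the left and right unfoldings. The total space $\overline{\mathcal M}_{\mathbf r}$ is the set of all $\bar{\mathcal X}$ with $\operatorname{rank}L(\mathcal X^k)=r_k$ and $\operatorname{rank}R(\mathcal X^k)=r_{k-1}$ for $k=1,\dots,d$.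 For $\bar\xi=(\xi^1,\dots,\xi^d)$ and $\bar\eta=(\eta^1,\dots,\eta^d)$ in $\prod_k\mathbb R^{r_{k-1}\times n_k\times r_k}$, the preconditioned metric is $$\bar g_{\bar{\mathcal X}}(\bar\xi,\bar\eta)=\sum_{k=1}^d\big\langle\phi(\mathcal X^1,\dots,\xi^k,\dots,\mathcal X^d),\ \phi(\mathcal X^1,\dots,\eta^k,\dots,\mathcal X^d)\big\rangle ,$$ where $\xi^k$ (resp. $\eta^k$) replaces $\mathcal X^k$ and $\langle\cdot,\cdot\rangle$ is the Euclidean inner product. The interface matrices are $\mathcal X^{\le k}\in\mathbb R^{n_1\cdots n_k\times r_k}$ with rows $\mathcal X^{\le k}(i_1,\dots,i_k;:)=\mathcal X^1(i_1)\cdots\mathcal X^k(i_k)$ and $\mathcal X^{\ge k}\in\mathbb R^{n_k\cdots n_d\times r_{k-1}}$ with rows $\mathcal X^{\ge k}(i_k,\dots,i_d;:)=[\mathcal X^k(i_k)\cdots\mathcal X^d(i_d)]^{\mathsf T}$, and $\mathcal X^{\le 0}=\mathcal X^{\ge d+1}=1$ (first mode indices fastest in the ordering of rows). The modified interface matrices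 $\mathcal X_\xi^{\le k,j}$ and $\mathcal X_\xi^{\ge k,j}$ are obtained from them by replacing $\mathcal X^j$ by $\xi^j$. Put $\mathbf L^k=(\mathcal X^{\le k})^{\mathsf T}\mathcal X^{\le k}$ and $\mathbf R^k=(\mathcal X^{\ge k})^{\mathsf T}\mathcal X^{\ge k}$, and let $\mathcal T^{<k>}$ be the unfolding of a tensor $\mathcal T$ with rows $(i_1,\dots,i_k)$ and columns $(i_{k+1},\dots,i_d)$. For $\bar\xi,\bar\lambda$ let $\bar\zeta=\bar\zeta_{\bar{\mathcal X}}(\bar\xi,\bar\lambda)=(\zeta^1,\dots,\zeta^d)$ be given by $$\begin{aligned} L(\zeta^k)={}&\big(I_{n_k}\otimes(\mathbf L^{k-1})^{-1}(\mathcal X^{\le k-1})^{\mathsf T}\big)\Big(\sum_{j\ne k}\phi(\mathcal X^1,\dots,\xi^j,\dots,\lambda^k,\dots,\mathcal X^d)\Big)^{<k>}\mathcal X^{\ge k+1}(\mathbf R^{k+1})^{-1}\\ &+\big(I_{n_k}\otimes(\mathbf L^{k-1})^{-1}(\mathcal X^{\le k-1})^{\mathsf T}\big)\Big(\sum_{j\ne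 k}\phi(\mathcal X^1,\dots,\lambda^j,\dots,\xi^k,\dots,\mathcal X^d)\Big)^{<k>}\mathcal X^{\ge k+1}(\mathbf R^{k+1})^{-1}\\ &+\sum_{j<k}\big(I_{n_k}\otimes(\mathbf L^{k-1})^{-1}(\mathcal X_\xi^{\le k-1,j})^{\mathsf T}\mathcal X^{\le k-1}\big)L(\lambda^k)+\sum_{j>k}L(\lambda^k)(\mathcal X^{\ge k+1})^{\mathsf T}\mathcal X_\xi^{\ge k+1,j}(\mathbf R^{k+1})^{-1}\\ &+\sum_{j<k}\big(I_{n_k}\otimes(\mathbf L^{k-1})^{-1}(\mathcal X_\lambda^{\le k-1,j})^{\mathsf T}\mathcal X^{\le k-1}\big)L(\xi^k)+\sum_{j>k}L(\xi^k)(\mathcal X^{\ge k+1})^{\mathsf T}\mathcal X_\lambda^{\ge k+1,j}(\mathbf R^{k+1})^{-1}\\ &-\sum_{j<k}\big(I_{n_k}\otimes(\mathbf L^{k-1})^{-1}(\mathcal X_\lambda^{\le k-1,j})^{\mathsf T}\mathcal X_\xi^{\le k-1,j}\big)L(\mathcal X^k)-\sum_{j>k}L(\mathcal X^k)(\mathcal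 X_\lambda^{\ge k+1,j})^{\mathsf T}\mathcal X_\xi^{\ge k+1,j}(\mathbf R^{k+1})^{-1}\\ &-\sum_{j<k}\big(I_{n_k}\otimes(\mathbf L^{k-1})^{-1}(\mathcal X_\xi^{\le k-1,j})^{\mathsf T}\mathcal X_\lambda^{\le k-1,j}\big)L(\mathcal X^k)-\sum_{j>k}L(\mathcal X^k)(\mathcal X_\xi^{\ge k+1,j})^{\mathsf T}\mathcal X_\lambda^{\ge k+1,j}(\mathbf R^{k+1})^{-1}. \end{aligned}$$ Then $\overline{\mathcal M}_{\mathbf r}$ is open in $\prod_k\mathbb R^{r_{k-1}\times n_k\times r_k}$, $\bar g$ is a smooth Riemannian metric on it, and its Levi-Civita connection $\nabla$ (the smooth, torsion-free covariant derivative compatible with $\bar g$) exists and satisfies, for every $\bar{\mathcal X}\in\overline{\mathcal M}_{\mathbf r}$, every tangent vector $\bar\xi$ at $\bar{\mathcal X}$ and every vector field $\bar\lambda$ that is differentiable at $\bar{\mathcal X}$, $$\nabla_{\bar\xi}\bar\lambda=\mathrm D\bar\lambda(\bar{\mathcal X})[\bar\xi]+\tfrac12\,\bar\zeta_{\bar{\mathcal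 X}}(\bar\xi,\bar\lambda_{\bar{\mathcal X}}).$$ -/

import Mathlib

open scoped Kronecker Manifold ContDiff Matrix

noncomputable section

/-! ### Riemannian metrics and the Levi-Civita connection on an open subset of a vector space

Every tangent space of an open set `U` of `E` is `E`; a vector field on `U` is a map `E → E` of
which only the values on `U` matter. -/

namespace FlatRiemannian

variable {E : Type*} [NormedAddCommGroup E] [NormedSpace ℝ E]

/-- `g x v w` is a smooth Riemannian metric on `U` (for finite-dimensional `E`, smoothness of the
tensor is smoothness of `x ↦ g x v w` for all fixed `v`, `w`). -/
structure IsRiemannianMetricOn (U : Set E) (g : E → E → E → ℝ) : Prop where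
  add_left : ∀ x ∈ U, ∀ v v' w : E, g x (v + v') w = g x v w + g x v' w
  smul_left : ∀ x ∈ U, ∀ (c : ℝ) (v w : E), g x (c • v) w = c * g x v w
  symm : ∀ x ∈ U, ∀ v w : E, g x v w = g x w v
  pos : ∀ x ∈ U, ∀ v : E, v ≠ 0 → 0 < g x v v
  smooth : ∀ v w : E, ContDiffOn ℝ ∞ (fun x => g x v w) U

/-- `cov` is the Levi-Civita (Riemannian) connection of the metric `g` on `U`: a smooth covariant
derivative on the tangent bundle that is torsion-free and compatible with `g`. As in Mathlib,
`cov Y x v` is `∇_v Y` at the point `x`. -/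
structure IsLeviCivitaOn (U : Set E) (g : E → E → E → ℝ)
    (cov : (E → E) → E → (E →L[ℝ] E)) : Prop where
  isCovariantDerivativeOn :
    IsCovariantDerivativeOn (I := 𝓘(ℝ, E)) (V := (TangentSpace 𝓘(ℝ, E) : E → Type _)) E cov U
  smooth : ∀ Y : E → E, ContDiffOn ℝ ∞ Y U → ContDiffOn ℝ ∞ (cov Y) U
  torsion_free : ∀ (X Y : E → E), ∀ x ∈ U, DifferentiableAt ℝ X x → DifferentiableAt ℝ Y x →
    cov Y x (X x) - cov X x (Y x) = VectorField.lieBracket ℝ X Y x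
  metric_compatible : ∀ (Y Z : E → E), ∀ x ∈ U, DifferentiableAt ℝ Y x → DifferentiableAt ℝ Z x →
    ∀ v : E, fderiv ℝ (fun y => g y (Y y) (Z y)) x v
      = g x (cov Y x v) (Z x) + g x (Y x) (cov Z x v)

end FlatRiemannian

/-! ### Tensor train format

Cores are numbered by `k : Fin d`; core `k` has size `r k.castSucc × n k × r k.succ`. The ranks
`r_0, …, r_d` are numbered by `m : Fin (d + 1)`. -/

namespace TensorTrain

variable {d : ℕ}

/-- Third-order tensors of the size of the `k`-th core. -/
abbrev Core (n : Fin d → ℕ) (r : Fin (d + 1) → ℕ) (k : Fin d) : Type :=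
  Fin (r k.castSucc) → Fin (n k) → Fin (r k.succ) → ℝ

/-- Families of `d` core tensors, without rank constraints. -/
abbrev Cores (n : Fin d → ℕ) (r : Fin (d + 1) → ℕ) : Type :=
  (k : Fin d) → Core n r k

/-- Multi-indices `(i_1, …, i_d)`. -/
abbrev MultiIndex (n : Fin d → ℕ) : Type := (j : Fin d) → Fin (n j)

/-- Multi-indices of the first `m` modes. -/
abbrev LeftIndex (n : Fin d → ℕ) (m : Fin (d + 1)) : Type :=
  (j : {j : Fin d // j.castSucc < m}) → Fin (n j)

/-- Multi-indices of the last `d - m` modes. -/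
abbrev RightIndex (n : Fin d → ℕ) (m : Fin (d + 1)) : Type :=
  (j : {j : Fin d // m ≤ j.castSucc}) → Fin (n j)

variable {n : Fin d → ℕ} {r : Fin (d + 1) → ℕ}

/-- The `i`-th slice of a core tensor, an `r_{k-1} × r_k` matrix. -/
def slice {k : Fin d} (Z : Core n r k) (i : Fin (n k)) :
    Matrix (Fin (r k.castSucc)) (Fin (r k.succ)) ℝ :=
  Matrix.of fun a b => Z a i b

/-- The left unfolding of a core, of size `r_{k-1} n_k × r_k`; the mode index `i` is the slow row
index, as in a Kronecker product with the identity of size `n_k` on the left. -/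
def leftUnfolding {k : Fin d} (Z : Core n r k) :
    Matrix (Fin (n k) × Fin (r k.castSucc)) (Fin (r k.succ)) ℝ :=
  Matrix.of fun p b => Z p.2 p.1 b

/-- The inverse of the left unfolding. -/
def leftFolding {k : Fin d} (A : Matrix (Fin (n k) × Fin (r k.castSucc)) (Fin (r k.succ)) ℝ) :
    Core n r k :=
  fun a i b => A (i, a) b

/-- The right unfolding of a core, of size `r_{k-1} × n_k r_k`. -/
def rightUnfolding {k : Fin d} (Z : Core n r k) :
    Matrix (Fin (r k.castSucc)) (Fin (r k.succ) × Fin (n k)) ℝ :=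
  Matrix.of fun a p => Z a p.2 p.1

/-- The total space: all left and right unfoldings of the cores have full rank. -/
def totalSpace (n : Fin d → ℕ) (r : Fin (d + 1) → ℕ) : Set (Cores n r) :=
  {X | ∀ k, (leftUnfolding (X k)).rank = r k.succ ∧ (rightUnfolding (X k)).rank = r k.castSucc}

/-- The left interface matrix with `m` factors: its row `(i_1, …, i_m)` is the row vector
`X¹(i_1) ⋯ Xᵐ(i_m)`. For `m = 0` it is `1` (recall `r_0 = 1`). -/
def leftInterface (X : Cores n r) (m : Fin (d + 1)) : Matrix (LeftIndex n m) (Fin (r m)) ℝ :=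
  Fin.induction (motive := fun m => Matrix (LeftIndex n m) (Fin (r m)) ℝ)
    (Matrix.of fun _ _ => 1)
    (fun k P => Matrix.of fun i => P (fun j => i ⟨j.1, j.2.trans k.castSucc_lt_succ⟩) ᵥ*
      slice (X k) (i ⟨k, k.castSucc_lt_succ⟩))
    m

/-- The right interface matrix with `d - m` factors: its row `(i_{m+1}, …, i_d)` is the transpose
of the column vector `X^{m+1}(i_{m+1}) ⋯ X^d(i_d)`. For `m = d` it is `1` (recall `r_d = 1`). -/
def rightInterface (X : Cores n r) (m : Fin (d + 1)) : Matrix (RightIndex n m) (Fin (r m)) ℝ :=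
  Fin.reverseInduction (motive := fun m => Matrix (RightIndex n m) (Fin (r m)) ℝ)
    (Matrix.of fun _ _ => 1)
    (fun k P => Matrix.of fun i => slice (X k) (i ⟨k, le_rfl⟩) *ᵥ
      P (fun j => i ⟨j.1, k.castSucc_lt_succ.le.trans j.2⟩))
    m

/-- The tensor represented by the cores: `φ(X)(i_1, …, i_d) = X¹(i_1) ⋯ X^d(i_d)`. The product is
a row vector of length `r_d = 1`, and the sum picks its only entry. -/
def phi (X : Cores n r) (i : MultiIndex n) : ℝ :=
  ∑ b, leftInterface X (Fin.last d) (fun j => i j.1) b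

/-- The preconditioned metric: the sum over `k` of the Euclidean inner products of
`φ(X¹, …, ξᵏ, …, X^d)` and `φ(X¹, …, ηᵏ, …, X^d)`. -/
def premetric (X ξ η : Cores n r) : ℝ :=
  ∑ k, ∑ i, phi (Function.update X k (ξ k)) i * phi (Function.update X k (η k)) i

/-- Put together `(i_1, …, i_{k-1})`, `i_k` and `(i_{k+1}, …, i_d)`. -/
def glue (k : Fin d) (i : LeftIndex n k.castSucc) (a : Fin (n k)) (i' : RightIndex n k.succ) :
    MultiIndex n := fun j =>
  if h : j.castSucc < k.castSucc then i ⟨j, h⟩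
  else if h' : k.succ ≤ j.castSucc then i' ⟨j, h'⟩
  else Fin.cast (congrArg n (by
    simp only [Fin.lt_def, Fin.le_def, Fin.val_castSucc, Fin.val_succ] at h h'
    exact Fin.ext (by omega))) a

/-- The unfolding of a tensor with rows `(i_1, …, i_k)` and columns `(i_{k+1}, …, i_d)`; the row
index is written as the pair of `i_k` and `(i_1, …, i_{k-1})`. -/
def unfolding (k : Fin d) (T : MultiIndex n → ℝ) :
    Matrix (Fin (n k) × LeftIndex n k.castSucc) (RightIndex n k.succ) ℝ :=
  Matrix.of fun p q => T (glue k p.2 p.1 q)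

/-- The product `X^{≤ m}ᵀ X^{≤ m}` of interface matrices. -/
def leftGram (X : Cores n r) (m : Fin (d + 1)) : Matrix (Fin (r m)) (Fin (r m)) ℝ :=
  (leftInterface X m)ᵀ * leftInterface X m

/-- The product `X^{≥ m+1}ᵀ X^{≥ m+1}` of interface matrices. -/
def rightGram (X : Cores n r) (m : Fin (d + 1)) : Matrix (Fin (r m)) (Fin (r m)) ℝ :=
  (rightInterface X m)ᵀ * rightInterface X m

/-- The modified left interface matrix: the `j`-th core of `X` is replaced by `ξʲ`. -/
def modLeft (X ξ : Cores n r) (m : Fin (d + 1)) (j : Fin d) :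
    Matrix (LeftIndex n m) (Fin (r m)) ℝ :=
  leftInterface (Function.update X j (ξ j)) m

/-- The modified right interface matrix: the `j`-th core of `X` is replaced by `ξʲ`. -/
def modRight (X ξ : Cores n r) (m : Fin (d + 1)) (j : Fin d) :
    Matrix (RightIndex n m) (Fin (r m)) ℝ :=
  rightInterface (Function.update X j (ξ j)) m

/-- The sum over `j ≠ k` of the tensors `φ(X¹, …, ξʲ, …, λᵏ, …, X^d)`. -/
def mixedSum (X ξ lam : Cores n r) (k : Fin d) : MultiIndex n → ℝ :=
  ∑ j ∈ Finset.univ.filter (fun j => j ≠ k),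
    phi (Function.update (Function.update X j (ξ j)) k (lam k))

/-- `(I ⊗ (L^{k-1})⁻¹ X^{≤ k-1}ᵀ) T^{<k>} X^{≥ k+1} (R^{k+1})⁻¹` for a tensor `T`. -/
def compress (X : Cores n r) (k : Fin d) (T : MultiIndex n → ℝ) :
    Matrix (Fin (n k) × Fin (r k.castSucc)) (Fin (r k.succ)) ℝ :=
  let M : Matrix (Fin (r k.castSucc)) (LeftIndex n k.castSucc) ℝ :=
    (leftGram X k.castSucc)⁻¹ * (leftInterface X k.castSucc)ᵀ
  let N : Matrix (RightIndex n k.succ) (Fin (r k.succ)) ℝ :=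
    rightInterface X k.succ * (rightGram X k.succ)⁻¹
  ((1 : Matrix (Fin (n k)) (Fin (n k)) ℝ) ⊗ₖ M) * unfolding k T * N

/-- `(I ⊗ (L^{k-1})⁻¹ Pᵀ Q) C` for matrices `P`, `Q` of the size of `X^{≤ k-1}` and a left
unfolded core `C`. -/
def leftCorrection (X : Cores n r) (k : Fin d)
    (P Q : Matrix (LeftIndex n k.castSucc) (Fin (r k.castSucc)) ℝ)
    (C : Matrix (Fin (n k) × Fin (r k.castSucc)) (Fin (r k.succ)) ℝ) :
    Matrix (Fin (n k) × Fin (r k.castSucc)) (Fin (r k.succ)) ℝ :=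
  ((1 : Matrix (Fin (n k)) (Fin (n k)) ℝ) ⊗ₖ ((leftGram X k.castSucc)⁻¹ * Pᵀ * Q)) * C

/-- `C Pᵀ Q (R^{k+1})⁻¹` for matrices `P`, `Q` of the size of `X^{≥ k+1}` and a left unfolded
core `C`. -/
def rightCorrection (X : Cores n r) (k : Fin d)
    (C : Matrix (Fin (n k) × Fin (r k.castSucc)) (Fin (r k.succ)) ℝ)
    (P Q : Matrix (RightIndex n k.succ) (Fin (r k.succ)) ℝ) :
    Matrix (Fin (n k) × Fin (r k.castSucc)) (Fin (r k.succ)) ℝ :=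
  C * Pᵀ * Q * (rightGram X k.succ)⁻¹

/-- The left unfolding of the `k`-th component of the correction term `ζ` of the connection. -/
def zetaUnfolded (X ξ lam : Cores n r) (k : Fin d) :
    Matrix (Fin (n k) × Fin (r k.castSucc)) (Fin (r k.succ)) ℝ :=
  let A := leftInterface X k.castSucc
  let B := rightInterface X k.succ
  let Aξ := modLeft X ξ k.castSucc
  let Alam := modLeft X lam k.castSucc
  let Bξ := modRight X ξ k.succ
  let Blam := modRight X lam k.succ
  compress X k (mixedSum X ξ lam k)
  + compress X k (mixedSum X lam ξ k)
  + (∑ j ∈ Finset.Iio k, leftCorrection X k (Aξ j) A (leftUnfolding (lam k)))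
  + (∑ j ∈ Finset.Ioi k, rightCorrection X k (leftUnfolding (lam k)) B (Bξ j))
  + (∑ j ∈ Finset.Iio k, leftCorrection X k (Alam j) A (leftUnfolding (ξ k)))
  + (∑ j ∈ Finset.Ioi k, rightCorrection X k (leftUnfolding (ξ k)) B (Blam j))
  - (∑ j ∈ Finset.Iio k, leftCorrection X k (Alam j) (Aξ j) (leftUnfolding (X k)))
  - (∑ j ∈ Finset.Ioi k, rightCorrection X k (leftUnfolding (X k)) (Blam j) (Bξ j))
  - (∑ j ∈ Finset.Iio k, leftCorrection X k (Aξ j) (Alam j) (leftUnfolding (X k)))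
  - (∑ j ∈ Finset.Ioi k, rightCorrection X k (leftUnfolding (X k)) (Bξ j) (Blam j))

/-- The correction term `ζ` at `X`, for the tangent vectors `ξ` and `lam` at `X`. -/
def zeta (X ξ lam : Cores n r) : Cores n r :=
  fun k => leftFolding (zetaUnfolded X ξ lam k)

end TensorTrain

end

/-! On an open set of a vector space the Levi-Civita connection is `fderiv` plus a field of bilinear
maps Γ, and Γ is determined by the Koszul formula on constant fields (`exists_leviCivita`,
`IsLeviCivitaOn.unique`). So it suffices that Γ = ζ/2 is smooth and satisfies g(ζ(ξ, λ), η) = ∂_ξ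
g(λ, η) + ∂_λ g(ξ, η) − ∂_η g(ξ, λ), which is `premetric_zeta`.

Since φ is multilinear, each derivative on the right is a sum of inner products of tensors φ with
one or two cores replaced. After exchanging the two summation indices in ∂_η, every term is a linear
form in a single core ηᵏ.

The k-th summand of the metric is, by `unfolding_phi`, the form ⟨(I ⊗ X^{≤k-1}) C (X^{≥k+1})ᵀ, (I ⊗
X^{≤k-1}) D (X^{≥k+1})ᵀ⟩. The full-rank conditions make both Gram matrices invertible, so the linear
form ⟨W, ·⟩ is represented by (I ⊗ (L^{k-1})⁻¹) W (R^{k+1})⁻¹ (`sum_phi_mul_represent`). Each term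
of ζᵏ is such a representative, with one Gram matrix cancelled in the correction terms.
Invertibility also gives positivity of the metric and, by Cramer's rule, smoothness of ζ. -/

noncomputable section

/-! ### Levi-Civita connections on open subsets of a vector space -/

namespace FlatRiemannian

variable {E : Type*} [NormedAddCommGroup E] [NormedSpace ℝ E]

/-- The tangent bundle of a vector space is trivialized by the identity. This links the
bundle-theoretic hypotheses of `IsCovariantDerivativeOn` with `fderiv`. -/
theorem differentiableAt_of_mdifferentiableAt_section
    {Y : (x : E) → TangentSpace 𝓘(ℝ, E) x} {x : E}
    (h : MDifferentiableAt 𝓘(ℝ, E) (𝓘(ℝ, E).prod 𝓘(ℝ, E))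
      (fun y => Bundle.TotalSpace.mk' E (E := (TangentSpace 𝓘(ℝ, E) : E → Type _)) y (Y y)) x) :
    DifferentiableAt ℝ (Y : E → E) x := by
  have h' := (mdifferentiableAt_section (F := E) (IB := 𝓘(ℝ, E)) Y).1 h
  simp only [trivializationAt_model_space_apply] at h'
  exact mdifferentiableAt_iff_differentiableAt.1 h'

theorem fderiv_add_christoffel_add (Γ : E → E →L[ℝ] E →L[ℝ] E) {Y Y' : E → E} {x : E}
    (hY : DifferentiableAt ℝ Y x) (hY' : DifferentiableAt ℝ Y' x) :
    fderiv ℝ (Y + Y') x + Γ x ((Y + Y') x)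
      = (fderiv ℝ Y x + Γ x (Y x)) + (fderiv ℝ Y' x + Γ x (Y' x)) := by
  rw [fderiv_add hY hY', Pi.add_apply, map_add]
  abel

theorem fderiv_add_christoffel_smul (Γ : E → E →L[ℝ] E →L[ℝ] E) {Y : E → E} {f : E → ℝ} {x : E}
    (hY : DifferentiableAt ℝ Y x) (hf : DifferentiableAt ℝ f x) :
    fderiv ℝ (f • Y) x + Γ x ((f • Y) x)
      = f x • (fderiv ℝ Y x + Γ x (Y x)) + (fderiv ℝ f x).smulRight (Y x) := by
  rw [fderiv_smul hf hY, Pi.smul_apply', map_smul, smul_add]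
  abel

/-- On an open subset of a vector space, a field of bilinear maps added to the flat derivative is a
covariant derivative. -/
theorem isCovariantDerivativeOn_fderiv_add (U : Set E) (Γ : E → E →L[ℝ] E →L[ℝ] E) :
    IsCovariantDerivativeOn (I := 𝓘(ℝ, E)) (V := (TangentSpace 𝓘(ℝ, E) : E → Type _)) E
      (fun (Y : E → E) x => fderiv ℝ Y x + Γ x (Y x)) U where
  add hY hY' _ :=
    fderiv_add_christoffel_add Γ (differentiableAt_of_mdifferentiableAt_section hY)
      (differentiableAt_of_mdifferentiableAt_section hY')
  leibniz {Y f x} hY hf _ := by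
    have h := fderiv_add_christoffel_smul Γ (differentiableAt_of_mdifferentiableAt_section hY)
      (mdifferentiableAt_iff_differentiableAt.1 hf)
    have hd : mfderiv 𝓘(ℝ, E) 𝓘(ℝ, ℝ) f x = fderiv ℝ f x := mfderiv_eq_fderiv
    rw [← hd] at h
    exact h

namespace IsRiemannianMetricOn

variable {U : Set E} {g : E → E → E → ℝ}

theorem add_right (hg : IsRiemannianMetricOn U g) {x : E} (hx : x ∈ U) (v w w' : E) :
    g x v (w + w') = g x v w + g x v w' := by
  rw [hg.symm x hx, hg.add_left x hx, hg.symm x hx w, hg.symm x hx w']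

theorem smul_right (hg : IsRiemannianMetricOn U g) {x : E} (hx : x ∈ U) (c : ℝ) (v w : E) :
    g x v (c • w) = c * g x v w := by
  rw [hg.symm x hx, hg.smul_left x hx, hg.symm x hx w]

theorem sub_left (hg : IsRiemannianMetricOn U g) {x : E} (hx : x ∈ U) (v v' w : E) :
    g x (v - v') w = g x v w - g x v' w := by
  rw [sub_eq_add_neg, hg.add_left x hx, ← neg_one_smul ℝ v', hg.smul_left x hx]
  ring

/-- Nondegeneracy, from positivity on `v - v'`. It turns every identity between pairings, the Koszul
formula in particular, into an identity between vectors. -/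
theorem eq_of_forall_left (hg : IsRiemannianMetricOn U g) {x : E} (hx : x ∈ U) {v v' : E}
    (h : ∀ w, g x v w = g x v' w) : v = v' := by
  by_contra hne
  have := hg.pos x hx (v - v') (sub_ne_zero.2 hne)
  rw [hg.sub_left hx, h, sub_self] at this
  exact lt_irrefl _ this

/-- A Riemannian metric, bundled as a smooth field of continuous bilinear forms. -/
theorem exists_bilinear [FiniteDimensional ℝ E] (hg : IsRiemannianMetricOn U g) :
    ∃ G : E → E →L[ℝ] E →L[ℝ] ℝ, (∀ x ∈ U, ∀ v w, G x v w = g x v w) ∧ ContDiffOn ℝ ∞ G U := by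
  have key : ∀ x, ∃ T : E →L[ℝ] E →L[ℝ] ℝ, x ∈ U → ∀ v w, T v w = g x v w := by
    intro x
    by_cases hx : x ∈ U
    · let B : E →ₗ[ℝ] E →ₗ[ℝ] ℝ := LinearMap.mk₂ ℝ (g x) (hg.add_left x hx) (hg.smul_left x hx)
        (hg.add_right hx) (hg.smul_right hx)
      exact ⟨LinearMap.toContinuousLinearMap
        (LinearMap.toContinuousLinearMap.toLinearMap ∘ₗ B), fun _ v w => rfl⟩
    -- Outside `U` nothing is known about `g`, and the value 0 is arbitrary.
    · exact ⟨0, fun h => absurd h hx⟩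
  choose G hG using key
  refine ⟨G, hG, contDiffOn_clm_apply.2 fun v => contDiffOn_clm_apply.2 fun w => ?_⟩
  exact (hg.smooth v w).congr fun x hx => hG x hx v w

theorem differentiableAt (hg : IsRiemannianMetricOn U g) (hU : IsOpen U) {x : E} (hx : x ∈ U)
    (v w : E) : DifferentiableAt ℝ (fun y => g y v w) x :=
  ((hg.smooth v w).contDiffAt (hU.mem_nhds hx)).differentiableAt (by simp)

theorem fderiv_symm (hg : IsRiemannianMetricOn U g) (hU : IsOpen U) {x : E} (hx : x ∈ U)
    (v w : E) : fderiv ℝ (fun y => g y v w) x = fderiv ℝ (fun y => g y w v) x :=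
  Filter.EventuallyEq.fderiv_eq <| by
    filter_upwards [hU.mem_nhds hx] with y hy using hg.symm y hy v w

theorem fderiv_add_left (hg : IsRiemannianMetricOn U g) (hU : IsOpen U) {x : E} (hx : x ∈ U)
    (v v' w : E) : fderiv ℝ (fun y => g y (v + v') w) x
      = fderiv ℝ (fun y => g y v w) x + fderiv ℝ (fun y => g y v' w) x := by
  rw [← fderiv_fun_add (hg.differentiableAt hU hx v w) (hg.differentiableAt hU hx v' w)]
  exact Filter.EventuallyEq.fderiv_eq <| by
    filter_upwards [hU.mem_nhds hx] with y hy using hg.add_left y hy v v' w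

theorem fderiv_smul_left (hg : IsRiemannianMetricOn U g) (hU : IsOpen U) {x : E} (hx : x ∈ U)
    (c : ℝ) (v w : E) : fderiv ℝ (fun y => g y (c • v) w) x = c • fderiv ℝ (fun y => g y v w) x := by
  rw [← fderiv_const_mul (hg.differentiableAt hU hx v w)]
  exact Filter.EventuallyEq.fderiv_eq <| by
    filter_upwards [hU.mem_nhds hx] with y hy using hg.smul_left y hy c v w

/-- The product rule for the inner product of two vector fields. -/
theorem fderiv_apply_fields [FiniteDimensional ℝ E] (hg : IsRiemannianMetricOn U g)
    (hU : IsOpen U) {x : E} (hx : x ∈ U) {Y Z : E → E} (hY : DifferentiableAt ℝ Y x)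
    (hZ : DifferentiableAt ℝ Z x) (v : E) :
    fderiv ℝ (fun y => g y (Y y) (Z y)) x v = fderiv ℝ (fun y => g y (Y x) (Z x)) x v
      + g x (fderiv ℝ Y x v) (Z x) + g x (Y x) (fderiv ℝ Z x v) := by
  obtain ⟨G, hG, hGs⟩ := hg.exists_bilinear
  have hGd : DifferentiableAt ℝ G x :=
    (hGs.contDiffAt (hU.mem_nhds hx)).differentiableAt (by simp)
  have h₁ : fderiv ℝ (fun y => g y (Y y) (Z y)) x = fderiv ℝ (fun y => G y (Y y) (Z y)) x :=
    Filter.EventuallyEq.fderiv_eq <| by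
      filter_upwards [hU.mem_nhds hx] with y hy using (hG y hy _ _).symm
  have h₂ : fderiv ℝ (fun y => g y (Y x) (Z x)) x = fderiv ℝ (fun y => G y (Y x) (Z x)) x :=
    Filter.EventuallyEq.fderiv_eq <| by
      filter_upwards [hU.mem_nhds hx] with y hy using (hG y hy _ _).symm
  have e₁ := (hGd.hasFDerivAt.clm_apply hY.hasFDerivAt).clm_apply hZ.hasFDerivAt
  have e₂ := (hGd.hasFDerivAt.clm_apply (hasFDerivAt_const (Y x) x)).clm_apply
    (hasFDerivAt_const (Z x) x)
  rw [h₁, h₂, e₁.fderiv, e₂.fderiv, ← hG x hx, ← hG x hx]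
  simp
  ring

/-- If `Γ` satisfies the Koszul formula on constant fields and is smooth, then adding it to the flat
derivative gives the Levi-Civita connection. -/
theorem exists_leviCivita [FiniteDimensional ℝ E] (hg : IsRiemannianMetricOn U g)
    (hU : IsOpen U) (Γ : E → E → E → E)
    (hΓ : ∀ x ∈ U, ∀ u v w, 2 * g x (Γ x u v) w = fderiv ℝ (fun y => g y v w) x u
      + fderiv ℝ (fun y => g y u w) x v - fderiv ℝ (fun y => g y u v) x w)
    (hΓs : ∀ u v, ContDiffOn ℝ ∞ (fun x => Γ x u v) U) :
    ∃ cov : (E → E) → E → (E →L[ℝ] E), IsLeviCivitaOn U g cov ∧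
      ∀ Y : E → E, ∀ x ∈ U, ∀ v, cov Y x v = fderiv ℝ Y x v + Γ x v (Y x) := by
  -- Neither symmetry nor bilinearity of Γ is assumed: both are inherited from the right-hand side
  -- of the Koszul formula by nondegeneracy.
  have symm : ∀ x ∈ U, ∀ u v, Γ x u v = Γ x v u := fun x hx u v =>
    hg.eq_of_forall_left hx fun w => by
      have h₁ := hΓ x hx u v w
      have h₂ := hΓ x hx v u w
      rw [hg.fderiv_symm hU hx v u] at h₂
      linarith
  have add : ∀ x ∈ U, ∀ u u' v, Γ x (u + u') v = Γ x u v + Γ x u' v := fun x hx u u' v =>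
    hg.eq_of_forall_left hx fun w => by
      have h₁ := hΓ x hx (u + u') v w
      have h₂ := hΓ x hx u v w
      have h₃ := hΓ x hx u' v w
      rw [hg.fderiv_add_left hU hx, hg.fderiv_add_left hU hx, map_add] at h₁
      simp only [add_apply] at h₁
      rw [hg.add_left x hx]
      linarith
  have smul : ∀ x ∈ U, ∀ (c : ℝ) u v, Γ x (c • u) v = c • Γ x u v := fun x hx c u v =>
    hg.eq_of_forall_left hx fun w => by
      have h₁ := hΓ x hx (c • u) v w
      have h₂ := hΓ x hx u v w
      rw [hg.fderiv_smul_left hU hx, hg.fderiv_smul_left hU hx, map_smul] at h₁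
      simp only [smul_apply, smul_eq_mul] at h₁
      rw [hg.smul_left x hx]
      linear_combination h₁ / 2 - c * h₂ / 2
  have key : ∀ x, ∃ T : E →L[ℝ] E →L[ℝ] E, x ∈ U → ∀ u v, T u v = Γ x u v := by
    intro x
    by_cases hx : x ∈ U
    · let B : E →ₗ[ℝ] E →ₗ[ℝ] E := LinearMap.mk₂ ℝ (Γ x) (add x hx) (smul x hx)
        (fun u v v' => by rw [symm x hx, add x hx, symm x hx v, symm x hx v'])
        (fun c u v => by rw [symm x hx, smul x hx, symm x hx v])
      exact ⟨LinearMap.toContinuousLinearMap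
        (LinearMap.toContinuousLinearMap.toLinearMap ∘ₗ B), fun _ v w => rfl⟩
    · exact ⟨0, fun h => absurd h hx⟩
  choose T hT using key
  have hTs : ContDiffOn ℝ ∞ T U := contDiffOn_clm_apply.2 fun u => contDiffOn_clm_apply.2 fun v =>
    (hΓs u v).congr fun x hx => hT x hx u v
  refine ⟨fun Y x => fderiv ℝ Y x + T x (Y x),
    ⟨isCovariantDerivativeOn_fderiv_add U T, ?_, ?_, ?_⟩, ?_⟩
  · intro Y hY
    exact (hY.fderiv_of_isOpen hU (by simp)).add (hTs.clm_apply hY)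
  · intro X Y x hx _ _
    simp only [add_apply, hT x hx, VectorField.lieBracket,
      symm x hx (X x) (Y x)]
    abel
  · intro Y Z x hx hY hZ v
    simp only [add_apply, hT x hx]
    rw [hg.fderiv_apply_fields hU hx hY hZ, hg.add_left x hx, hg.add_right hx,
      hg.symm x hx (Y x) (Γ x _ _), symm x hx (Y x), symm x hx (Z x)]
    -- In the sum of these two Koszul identities only twice the derivative of `g` along `v`
    -- survives.
    have h₁ := hΓ x hx v (Y x) (Z x)
    have h₂ := hΓ x hx v (Z x) (Y x)
    rw [hg.fderiv_symm hU hx (Z x) (Y x)] at h₂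
    linarith
  · intro Y x hx v
    rw [add_apply, hT x hx, symm x hx]

end IsRiemannianMetricOn

/-- Uniqueness of the Levi-Civita connection, pointwise and for fields differentiable only at the
point. -/
theorem IsLeviCivitaOn.unique {U : Set E} {g : E → E → E → ℝ}
    (hg : IsRiemannianMetricOn U g) {cov cov' : (E → E) → E → (E →L[ℝ] E)}
    (h : IsLeviCivitaOn U g cov) (h' : IsLeviCivitaOn U g cov') {x : E} (hx : x ∈ U)
    {Y : E → E} (hY : DifferentiableAt ℝ Y x) : cov Y x = cov' Y x := by
  have tors : ∀ X Z : E → E, DifferentiableAt ℝ X x → DifferentiableAt ℝ Z x →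
      cov Z x (X x) - cov' Z x (X x) = cov X x (Z x) - cov' X x (Z x) := by
    intro X Z hX hZ
    have := (h.torsion_free X Z x hx hX hZ).trans (h'.torsion_free X Z x hx hX hZ).symm
    rw [sub_eq_sub_iff_add_eq_add] at this ⊢
    rw [this, add_comm]
  have compat : ∀ X Z : E → E, DifferentiableAt ℝ X x → DifferentiableAt ℝ Z x → ∀ v,
      g x (cov X x v - cov' X x v) (Z x) = - g x (cov Z x v - cov' Z x v) (X x) := by
    intro X Z hX hZ v
    have := (h.metric_compatible X Z x hx hX hZ v).symm.trans
      (h'.metric_compatible X Z x hx hX hZ v)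
    rw [hg.sub_left hx, hg.sub_left hx, hg.symm x hx (cov Z x v), hg.symm x hx (cov' Z x v)]
    linarith
  ext v
  refine hg.eq_of_forall_left hx fun w => ?_
  have hv : DifferentiableAt ℝ (fun _ : E => v) x := differentiableAt_const v
  have hw : DifferentiableAt ℝ (fun _ : E => w) x := differentiableAt_const w
  -- Let t(a, b, c) = g(∇_a b − ∇'_a b, c) for a, b, c among `Y` and the constant fields `v`, `w`.
  -- It is symmetric in a, b by `tors` and antisymmetric in b, c by `compat`. Three swaps of each
  -- kind, alternating, give t = −t, with no appeal to tensoriality in `Y`.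
  have a₁ := compat Y _ hY hw v
  have a₂ := compat _ _ hw hv (Y x)
  have a₃ := compat _ _ hv hY w
  have t₁ := tors _ _ hv hw
  have t₂ := tors _ _ hY hw
  have t₃ := tors _ _ hv hY
  rw [← t₁] at a₃
  rw [t₂] at a₂
  rw [t₃] at a₁
  rw [← sub_eq_zero, ← hg.sub_left hx, t₃]
  linarith

end FlatRiemannian

namespace TensorTrain

variable {d : ℕ} {n : Fin d → ℕ} {r : Fin (d + 1) → ℕ}

/-! ### Interface matrices -/

theorem leftInterface_succ (X : Cores n r) (k : Fin d) (i : LeftIndex n k.succ) :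
    leftInterface X k.succ i
      = leftInterface X k.castSucc (fun j => i ⟨j.1, j.2.trans k.castSucc_lt_succ⟩) ᵥ*
        slice (X k) (i ⟨k, k.castSucc_lt_succ⟩) := rfl

theorem rightInterface_last (X : Cores n r) :
    rightInterface X (Fin.last d) = Matrix.of fun _ _ => 1 := by
  unfold rightInterface
  rw [Fin.reverseInduction_last]

theorem rightInterface_castSucc (X : Cores n r) (k : Fin d) (i : RightIndex n k.castSucc) :
    rightInterface X k.castSucc i = slice (X k) (i ⟨k, le_rfl⟩) *ᵥ
      rightInterface X k.succ (fun j => i ⟨j.1, k.castSucc_lt_succ.le.trans j.2⟩) := by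
  unfold rightInterface
  rw [Fin.reverseInduction_castSucc]
  rfl

theorem leftInterface_congr {X Y : Cores n r} (m : Fin (d + 1))
    (h : ∀ j : Fin d, j.castSucc < m → X j = Y j) : leftInterface X m = leftInterface Y m := by
  induction m using Fin.induction with
  | zero => rfl
  | succ k ih =>
    funext i
    rw [leftInterface_succ, leftInterface_succ, ih fun j hj => h j (hj.trans k.castSucc_lt_succ),
      h k k.castSucc_lt_succ]

theorem rightInterface_congr {X Y : Cores n r} (m : Fin (d + 1))
    (h : ∀ j : Fin d, m ≤ j.castSucc → X j = Y j) : rightInterface X m = rightInterface Y m := by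
  induction m using Fin.reverseInduction with
  | last => rw [rightInterface_last, rightInterface_last]
  | cast k ih =>
    funext i
    rw [rightInterface_castSucc, rightInterface_castSucc,
      ih fun j hj => h j (k.castSucc_lt_succ.le.trans hj), h k le_rfl]

theorem leftInterface_update {m : Fin (d + 1)} {j : Fin d} (h : m ≤ j.castSucc) (X : Cores n r)
    (v : Core n r j) : leftInterface (Function.update X j v) m = leftInterface X m :=
  leftInterface_congr m fun i hi => Function.update_of_ne (by
    rintro rfl
    exact (lt_of_lt_of_le hi h).false) _ _

theorem rightInterface_update {m : Fin (d + 1)} {j : Fin d} (h : j.castSucc < m) (X : Cores n r)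
    (v : Core n r j) : rightInterface (Function.update X j v) m = rightInterface X m :=
  rightInterface_congr m fun i hi => Function.update_of_ne (by
    rintro rfl
    exact (lt_of_lt_of_le h hi).false) _ _

/-- The train can be cut at any position: moving core k across the cut is associativity of the
matrix product. -/
theorem phi_eq_dotProduct (X : Cores n r) (i : MultiIndex n) (m : Fin (d + 1)) :
    phi X i = leftInterface X m (fun j => i j.1) ⬝ᵥ rightInterface X m (fun j => i j.1) := by
  induction m using Fin.reverseInduction with
  | last => simp [phi, rightInterface_last, dotProduct]
  | cast k ih =>
    rw [ih, rightInterface_castSucc, leftInterface_succ, Matrix.dotProduct_mulVec]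

theorem glue_left (k : Fin d) (i : LeftIndex n k.castSucc) (a : Fin (n k))
    (i' : RightIndex n k.succ) (j : {j : Fin d // j.castSucc < k.castSucc}) :
    glue k i a i' j.1 = i j := by
  simp only [glue, dif_pos j.2]

theorem glue_right (k : Fin d) (i : LeftIndex n k.castSucc) (a : Fin (n k))
    (i' : RightIndex n k.succ) (j : {j : Fin d // k.succ ≤ j.castSucc}) :
    glue k i a i' j.1 = i' j := by
  have h : ¬ j.1.castSucc < k.castSucc := fun h =>
    (lt_of_lt_of_le k.castSucc_lt_succ j.2).not_gt h
  simp only [glue, dif_neg h, dif_pos j.2]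

theorem glue_self (k : Fin d) (i : LeftIndex n k.castSucc) (a : Fin (n k))
    (i' : RightIndex n k.succ) : glue k i a i' k = a := by
  have h : ¬ k.succ ≤ k.castSucc := k.castSucc_lt_succ.not_ge
  simp only [glue, dif_neg (lt_irrefl k.castSucc), dif_neg h]
  rfl

theorem glue_restrict (k : Fin d) (i : MultiIndex n) :
    glue k (fun j => i j.1) (i k) (fun j => i j.1) = i := by
  funext j
  rcases lt_trichotomy j k with h | rfl | h
  · exact glue_left k _ _ _ ⟨j, Fin.castSucc_lt_castSucc_iff.2 h⟩
  · exact glue_self ..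
  · exact glue_right k _ _ _ ⟨j, Fin.succ_le_castSucc_iff.2 h⟩

/-- Splitting a multi-index into `i_k`, the indices before and the indices after `k`. -/
def splitEquiv (n : Fin d → ℕ) (k : Fin d) :
    MultiIndex n ≃ (Fin (n k) × LeftIndex n k.castSucc) × RightIndex n k.succ where
  toFun i := ((i k, fun j => i j.1), fun j => i j.1)
  invFun p := glue k p.1.2 p.1.1 p.2
  left_inv i := glue_restrict k i
  right_inv p := by
    refine Prod.ext (Prod.ext (glue_self ..) (funext fun j => glue_left ..))
      (funext fun j => glue_right ..)

/-! ### Unfoldings -/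

theorem unfolding_injective (k : Fin d) :
    Function.Injective (unfolding k : (MultiIndex n → ℝ) → _) := by
  intro S T h
  funext i
  have := congrFun (congrFun h (i k, fun j => i j.1)) (fun j => i j.1)
  simpa [unfolding, glue_restrict] using this

/-- Cutting on both sides of core k makes φ visibly linear in that core. All later computations with
φ go through this factorization. -/
theorem unfolding_phi (X : Cores n r) (k : Fin d) :
    unfolding k (phi X) = ((1 : Matrix (Fin (n k)) (Fin (n k)) ℝ) ⊗ₖ leftInterface X k.castSucc)
      * leftUnfolding (X k) * (rightInterface X k.succ)ᵀ := by
  ext ⟨a, i⟩ i'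
  rw [unfolding, Matrix.of_apply, phi_eq_dotProduct X _ k.succ, leftInterface_succ,
    Matrix.mul_apply]
  simp only [glue_right, glue_self, dotProduct, Matrix.transpose_apply]
  refine Finset.sum_congr rfl fun b _ => ?_
  congr 1
  rw [Matrix.mul_apply, Fintype.sum_prod_type]
  simp only [Matrix.kroneckerMap_apply, Matrix.one_apply, leftUnfolding, Matrix.of_apply, ite_mul,
    one_mul, zero_mul]
  -- The identity factor of the Kronecker product keeps only the block of the mode index `a`.
  rw [Finset.sum_eq_single a (fun b _ h => by simp [Ne.symm h]) (by simp)]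
  simp only [if_true, Matrix.vecMul, dotProduct, slice, Matrix.of_apply]
  refine Finset.sum_congr rfl fun c _ => ?_
  congr 2
  funext j
  exact glue_left k i a i' ⟨j.1, j.2⟩

theorem sum_mul_eq_trace (k : Fin d) (S T : MultiIndex n → ℝ) :
    ∑ i, S i * T i = ((unfolding k S)ᵀ * unfolding k T).trace := by
  rw [← (splitEquiv n k).symm.sum_comp, Fintype.sum_prod_type, Finset.sum_comm]
  simp only [Matrix.trace, Matrix.diag, Matrix.mul_apply]
  rfl

theorem unfolding_add (k : Fin d) (S T : MultiIndex n → ℝ) :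
    unfolding k (S + T) = unfolding k S + unfolding k T := rfl

theorem unfolding_smul (k : Fin d) (c : ℝ) (T : MultiIndex n → ℝ) :
    unfolding k (c • T) = c • unfolding k T := rfl

theorem leftUnfolding_add {k : Fin d} (Y Z : Core n r k) :
    leftUnfolding (Y + Z) = leftUnfolding Y + leftUnfolding Z := rfl

theorem leftUnfolding_smul {k : Fin d} (c : ℝ) (Z : Core n r k) :
    leftUnfolding (c • Z) = c • leftUnfolding Z := rfl

theorem leftUnfolding_leftFolding {k : Fin d}
    (A : Matrix (Fin (n k) × Fin (r k.castSucc)) (Fin (r k.succ)) ℝ) :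
    leftUnfolding (leftFolding A) = A := rfl

theorem unfolding_phi_update (X : Cores n r) (k : Fin d) (Z : Core n r k) :
    unfolding k (phi (Function.update X k Z))
      = ((1 : Matrix (Fin (n k)) (Fin (n k)) ℝ) ⊗ₖ leftInterface X k.castSucc)
      * leftUnfolding Z * (rightInterface X k.succ)ᵀ := by
  rw [unfolding_phi, leftInterface_update le_rfl, rightInterface_update k.castSucc_lt_succ,
    Function.update_self]

/-- `φ` as a multilinear map of the cores. -/
def phiMultilinear (n : Fin d → ℕ) (r : Fin (d + 1) → ℕ) :
    MultilinearMap ℝ (Core n r) (MultiIndex n → ℝ) where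
  toFun := phi
  map_update_add' {inst} X k Y Z := by
    -- `MultilinearMap` quantifies over all decidable equalities on the index type, whereas the
    -- lemmas about `phi` use the standard one.
    obtain rfl := Subsingleton.elim inst (instDecidableEqFin d)
    apply unfolding_injective k
    simp only [unfolding_add, unfolding_phi_update, leftUnfolding_add, Matrix.mul_add,
      Matrix.add_mul]
  map_update_smul' {inst} X k c Z := by
    obtain rfl := Subsingleton.elim inst (instDecidableEqFin d)
    apply unfolding_injective k
    simp only [unfolding_smul, unfolding_phi_update, leftUnfolding_smul, Matrix.mul_smul,
      Matrix.smul_mul]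

/-! ### Smoothness -/

theorem contDiff_entry (k : Fin d) (a : Fin (r k.castSucc)) (i : Fin (n k)) (b : Fin (r k.succ)) :
    ContDiff ℝ ∞ (fun X : Cores n r => X k a i b) :=
  contDiff_pi.1 (contDiff_pi.1 (contDiff_pi.1 (contDiff_pi.1 contDiff_id k) a) i) b

theorem contDiff_leftInterface (m : Fin (d + 1)) (i : LeftIndex n m) (b : Fin (r m)) :
    ContDiff ℝ ∞ (fun X : Cores n r => leftInterface X m i b) := by
  induction m using Fin.induction with
  | zero => exact contDiff_const
  | succ k ih =>
    simp only [leftInterface_succ, Matrix.vecMul, dotProduct, slice, Matrix.of_apply]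
    exact ContDiff.sum fun a _ => (ih _ a).mul (contDiff_entry ..)

theorem contDiff_rightInterface (m : Fin (d + 1)) (i : RightIndex n m) (b : Fin (r m)) :
    ContDiff ℝ ∞ (fun X : Cores n r => rightInterface X m i b) := by
  induction m using Fin.reverseInduction with
  | last =>
    simp only [rightInterface_last]
    exact contDiff_const
  | cast k ih =>
    simp only [rightInterface_castSucc, Matrix.mulVec, dotProduct, slice, Matrix.of_apply]
    exact ContDiff.sum fun a _ => (contDiff_entry ..).mul (ih _ a)

theorem contDiff_phi (i : MultiIndex n) : ContDiff ℝ ∞ (fun X : Cores n r => phi X i) :=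
  ContDiff.sum fun _ _ => contDiff_leftInterface _ _ _

theorem contDiff_update (k : Fin d) (v : Core n r k) :
    ContDiff ℝ ∞ (fun X : Cores n r => Function.update X k v) := by
  refine contDiff_pi.2 fun j => ?_
  by_cases h : j = k
  · subst h
    simpa using contDiff_const
  · simpa [Function.update_of_ne h] using contDiff_pi.1 contDiff_id j

theorem phi_update_zero (X : Cores n r) (k : Fin d) : phi (Function.update X k 0) = 0 :=
  (phiMultilinear n r).map_update_zero X k

/-- Product rule for a multilinear map. Core k is frozen at `v k`, so its own term has a zero core
and drops out, leaving the sum over j ≠ k. -/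
theorem fderiv_phi_update (X : Cores n r) (k : Fin d) (v ξ : Cores n r) (i : MultiIndex n) :
    fderiv ℝ (fun Y : Cores n r => phi (Function.update Y k (v k)) i) X ξ = mixedSum X ξ v k i := by
  let f : ContinuousMultilinearMap ℝ (Core n r) (MultiIndex n → ℝ) :=
    { phiMultilinear n r with
      cont := continuous_pi fun i => (contDiff_phi i).continuous }
  let u' : (j : Fin d) → Cores n r →L[ℝ] Core n r j := fun j =>
    if j = k then 0 else ContinuousLinearMap.proj (R := ℝ) (φ := Core n r) j
  have hu : ∀ j, HasFDerivAt (fun Y : Cores n r => Function.update Y k (v k) j) (u' j) X := by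
    intro j
    by_cases h : j = k
    · subst h
      simpa [u'] using hasFDerivAt_const (𝕜 := ℝ) (v j) X
    · simp only [Function.update_of_ne h, u', if_neg h]
      exact (ContinuousLinearMap.proj (R := ℝ) (φ := Core n r) j).hasFDerivAt
  have hd := hasFDerivAt_pi'.1 (HasFDerivAt.multilinear_comp f hu) i
  have hf : (fun Y : Cores n r => phi (Function.update Y k (v k)) i)
      = fun Y => f (fun j => Function.update Y k (v k) j) i := rfl
  rw [hf, hd.fderiv]
  simp only [ContinuousLinearMap.comp_apply, ContinuousLinearMap.proj_apply, mixedSum,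
    sum_apply, Finset.sum_apply, Finset.sum_filter]
  refine Finset.sum_congr rfl fun j _ => ?_
  change phi (Function.update (Function.update X k (v k)) j (u' j ξ)) i = _
  by_cases h : j = k
  · subst h
    simp [u', phi_update_zero]
  · simp only [u', h, if_false, ne_eq, not_false_eq_true, if_true,
      ContinuousLinearMap.proj_apply]
    rw [Function.update_comm h]

theorem contDiff_premetric (v w : Cores n r) :
    ContDiff ℝ ∞ (fun X : Cores n r => premetric X v w) :=
  ContDiff.sum fun k _ => ContDiff.sum fun i _ =>
    ((contDiff_phi i).comp (contDiff_update k _)).mul ((contDiff_phi i).comp (contDiff_update k _))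

end TensorTrain

/-! ### Full column rank -/

namespace Matrix

theorem one_kronecker_mul {κ μ ν : Type*} [Fintype κ] (s : ℕ) (A : Matrix μ κ ℝ)
    (B : Matrix κ ν ℝ) :
    (1 : Matrix (Fin s) (Fin s) ℝ) ⊗ₖ (A * B)
      = ((1 : Matrix (Fin s) (Fin s) ℝ) ⊗ₖ A) * ((1 : Matrix (Fin s) (Fin s) ℝ) ⊗ₖ B) := by
  rw [← mul_kronecker_mul, Matrix.one_mul]

variable {ι κ : Type*} [Fintype ι] [Fintype κ] [DecidableEq κ]

/-- A matrix and its Gram matrix have the same rank. This makes the rank conditions nonvanishing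
conditions on polynomials, hence open. -/
theorem det_transpose_mul_self_ne_zero_iff_rank {A : Matrix ι κ ℝ} :
    (Aᵀ * A).det ≠ 0 ↔ A.rank = Fintype.card κ := by
  rw [← rank_transpose_mul_self, ← isUnit_iff_ne_zero, ← isUnit_iff_isUnit_det]
  constructor
  · exact rank_of_isUnit _
  · intro h
    rw [← linearIndependent_cols_iff_isUnit, linearIndependent_iff_card_eq_finrank_span, Set.finrank,
      ← rank_eq_finrank_span_cols, h]

/-- If AᵀAv = 0 then |Av|² = 0, so A and AᵀA have the same kernel. -/
theorem det_transpose_mul_self_ne_zero_iff {A : Matrix ι κ ℝ} :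
    (Aᵀ * A).det ≠ 0 ↔ ∀ v, A *ᵥ v = 0 → v = 0 := by
  rw [← not_iff_not, not_not, ← exists_mulVec_eq_zero_iff]
  push Not
  constructor
  · rintro ⟨v, hv, h⟩
    refine ⟨v, ?_, hv⟩
    rw [← dotProduct_self_eq_zero, dotProduct_mulVec, ← mulVec_transpose, mulVec_mulVec, h,
      zero_dotProduct]
  · rintro ⟨v, h, hv⟩
    exact ⟨v, hv, by rw [← mulVec_mulVec, h, mulVec_zero]⟩

theorem one_kronecker_transpose {μ ν : Type*} (s : ℕ) (A : Matrix μ ν ℝ) :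
    (1 : Matrix (Fin s) (Fin s) ℝ) ⊗ₖ Aᵀ = ((1 : Matrix (Fin s) (Fin s) ℝ) ⊗ₖ A)ᵀ := by
  rw [← kroneckerMap_transpose, transpose_one]

end Matrix

/-! ### Openness of the total space and injectivity of the interface matrices -/

namespace TensorTrain

variable {d : ℕ} {n : Fin d → ℕ} {r : Fin (d + 1) → ℕ}

theorem mem_totalSpace_iff {X : Cores n r} : X ∈ totalSpace n r ↔
    ∀ k, ((leftUnfolding (X k))ᵀ * leftUnfolding (X k)).det ≠ 0 ∧
      ((rightUnfolding (X k))ᵀᵀ * (rightUnfolding (X k))ᵀ).det ≠ 0 := by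
  simp only [Matrix.det_transpose_mul_self_ne_zero_iff_rank, Matrix.rank_transpose,
    Fintype.card_fin]
  rfl

theorem isOpen_totalSpace : IsOpen (totalSpace n r) := by
  have hc : ∀ k a i b, Continuous (fun X : Cores n r => X k a i b) := fun k a i b =>
    (contDiff_entry k a i b).continuous
  have hL : ∀ k, Continuous (fun X : Cores n r => leftUnfolding (X k)) := fun k =>
    continuous_matrix fun p b => hc k p.2 p.1 b
  have hR : ∀ k, Continuous (fun X : Cores n r => rightUnfolding (X k)) := fun k =>
    continuous_matrix fun a p => hc k a p.2 p.1
  have : totalSpace n r = ⋂ k,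
      ({X | ((leftUnfolding (X k))ᵀ * leftUnfolding (X k)).det ≠ 0} ∩
        {X | ((rightUnfolding (X k))ᵀᵀ * (rightUnfolding (X k))ᵀ).det ≠ 0}) := by
    ext X
    simp [mem_totalSpace_iff]
  rw [this]
  refine isOpen_iInter_of_finite fun k => IsOpen.inter ?_ ?_
  · exact isOpen_ne_fun ((hL k).matrix_transpose.matrix_mul (hL k)).matrix_det continuous_const
  · exact isOpen_ne_fun ((hR k).matrix_transpose.matrix_transpose.matrix_mul
      (hR k).matrix_transpose).matrix_det continuous_const

theorem eq_zero_of_ones_mulVec_eq_zero {ι : Type*} [Nonempty ι] {s : ℕ} (hs : s = 1)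
    {v : Fin s → ℝ} (hv : (Matrix.of fun (_ : ι) (_ : Fin s) => (1 : ℝ)) *ᵥ v = 0) : v = 0 := by
  subst hs
  obtain ⟨i⟩ := ‹Nonempty ι›
  have := congrFun hv i
  funext b
  rw [Subsingleton.elim b 0]
  simpa [Matrix.mulVec, dotProduct] using this

/-- X^{≤k} is (I ⊗ X^{≤k-1}) L(Xᵏ) up to ordering of rows, a product of injective maps. The base
case is the 1 × 1 matrix 1, by r_0 = 1. -/
theorem eq_zero_of_leftInterface_mulVec_eq_zero (h0 : r 0 = 1) {X : Cores n r}
    (hX : X ∈ totalSpace n r) (m : Fin (d + 1)) :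
    ∀ v, leftInterface X m *ᵥ v = 0 → v = 0 := by
  induction m using Fin.induction with
  | zero =>
    intro v hv
    have : Nonempty (LeftIndex n 0) := ⟨fun j => absurd j.2 (Fin.not_lt_zero _)⟩
    exact eq_zero_of_ones_mulVec_eq_zero h0 hv
  | succ k ih =>
    intro v hv
    refine Matrix.det_transpose_mul_self_ne_zero_iff.1 (mem_totalSpace_iff.1 hX k).1 v ?_
    funext ⟨a, c⟩
    refine congrFun (ih (slice (X k) a *ᵥ v) (funext fun i => ?_)) c
    -- The row index `i` is extended by the value `a` at mode k.
    have key : ∃ i' : LeftIndex n k.succ, (i' ⟨k, k.castSucc_lt_succ⟩ = a) ∧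
        ∀ j : {j : Fin d // j.castSucc < k.castSucc},
          i' ⟨j.1, j.2.trans k.castSucc_lt_succ⟩ = i j := by
      refine ⟨fun j => if h : j.1 = k then Fin.cast (congrArg n h.symm) a else
        i ⟨j.1, Fin.castSucc_lt_castSucc_iff.2
          (lt_of_le_of_ne (Fin.castSucc_lt_succ_iff.1 j.2) h)⟩, by simp, fun j => ?_⟩
      have h : j.1 ≠ k := (Fin.castSucc_lt_castSucc_iff.1 j.2).ne
      simp [h]
    obtain ⟨i', h₁, h₂⟩ := key
    have := congrFun hv i'
    rw [Matrix.mulVec, leftInterface_succ, ← Matrix.dotProduct_mulVec, h₁, funext h₂] at this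
    exact this

/-- Mirror image, starting from r_d = 1 and using that R(Xᵏ)ᵀ is injective. -/
theorem eq_zero_of_rightInterface_mulVec_eq_zero (hd : r (Fin.last d) = 1) {X : Cores n r}
    (hX : X ∈ totalSpace n r) (m : Fin (d + 1)) :
    ∀ v, rightInterface X m *ᵥ v = 0 → v = 0 := by
  induction m using Fin.reverseInduction with
  | last =>
    intro v hv
    have : Nonempty (RightIndex n (Fin.last d)) :=
      ⟨fun j => absurd j.2 (Fin.castSucc_lt_last _).not_ge⟩
    rw [rightInterface_last] at hv
    exact eq_zero_of_ones_mulVec_eq_zero hd hv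
  | cast k ih =>
    intro v hv
    refine Matrix.det_transpose_mul_self_ne_zero_iff.1 (mem_totalSpace_iff.1 hX k).2 v ?_
    funext ⟨c, a⟩
    rw [Matrix.mulVec_transpose]
    refine congrFun (ih (v ᵥ* slice (X k) a) (funext fun i => ?_)) c
    have key : ∃ i' : RightIndex n k.castSucc, (i' ⟨k, le_rfl⟩ = a) ∧
        ∀ j : {j : Fin d // k.succ ≤ j.castSucc},
          i' ⟨j.1, k.castSucc_lt_succ.le.trans j.2⟩ = i j := by
      refine ⟨fun j => if h : j.1 = k then Fin.cast (congrArg n h.symm) a else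
        i ⟨j.1, Fin.succ_le_castSucc_iff.2
          (lt_of_le_of_ne (Fin.castSucc_le_castSucc_iff.1 j.2) (Ne.symm h))⟩, by simp, fun j => ?_⟩
      have h : j.1 ≠ k := (Fin.succ_le_castSucc_iff.1 j.2).ne'
      simp [h]
    obtain ⟨i', h₁, h₂⟩ := key
    have := congrFun hv i'
    rw [Matrix.mulVec, rightInterface_castSucc, dotProduct_comm, Matrix.dotProduct_mulVec, h₁,
      funext h₂, dotProduct_comm] at this
    exact this

theorem det_leftGram_ne_zero (h0 : r 0 = 1) {X : Cores n r} (hX : X ∈ totalSpace n r)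
    (m : Fin (d + 1)) : (leftGram X m).det ≠ 0 :=
  Matrix.det_transpose_mul_self_ne_zero_iff.2 (eq_zero_of_leftInterface_mulVec_eq_zero h0 hX m)

theorem det_rightGram_ne_zero (hd : r (Fin.last d) = 1) {X : Cores n r} (hX : X ∈ totalSpace n r)
    (m : Fin (d + 1)) : (rightGram X m).det ≠ 0 :=
  Matrix.det_transpose_mul_self_ne_zero_iff.2 (eq_zero_of_rightInterface_mulVec_eq_zero hd hX m)

/-! ### The Gram matrices and representation of linear forms on a core -/

/-- If `H` and `K` are inverse to the Gram matrices of `P` and `B`, then `H W K` represents the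
linear form `⟨W, ·⟩` for the inner product `⟨P C Bᵀ, P D Bᵀ⟩`. -/
theorem trace_represent {ι κ μ ν : Type*} [Fintype ι] [Fintype κ] [Fintype μ] [Fintype ν]
    [DecidableEq κ] [DecidableEq ν] {P : Matrix ι κ ℝ} {B : Matrix μ ν ℝ} {H : Matrix κ κ ℝ}
    {K : Matrix ν ν ℝ} (hH : Pᵀ * P * H = 1) (hK : K * (Bᵀ * B) = 1) (W D : Matrix κ ν ℝ) :
    ((P * (H * W * K) * Bᵀ)ᵀ * (P * D * Bᵀ)).trace = (Wᵀ * D).trace := by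
  have hH' : Hᵀ * (Pᵀ * P) = 1 := by
    have := congrArg Matrix.transpose hH
    simpa [Matrix.transpose_mul] using this
  have hK' : Bᵀ * B * Kᵀ = 1 := by
    have := congrArg Matrix.transpose hK
    simpa [Matrix.transpose_mul] using this
  calc ((P * (H * W * K) * Bᵀ)ᵀ * (P * D * Bᵀ)).trace
      = (B * (Kᵀ * Wᵀ * (Hᵀ * (Pᵀ * P)) * D * Bᵀ)).trace := by
        simp only [Matrix.transpose_mul, Matrix.transpose_transpose, Matrix.mul_assoc]
    _ = (Kᵀ * (Wᵀ * D * (Bᵀ * B))).trace := by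
        rw [Matrix.trace_mul_comm, hH', Matrix.mul_one]
        simp only [Matrix.mul_assoc]
    _ = (Wᵀ * D).trace := by
        rw [Matrix.trace_mul_comm, Matrix.mul_assoc, hK', Matrix.mul_one]

theorem kronecker_gram_mul_inv (h0 : r 0 = 1) {X : Cores n r} (hX : X ∈ totalSpace n r)
    (k : Fin d) :
    ((1 : Matrix (Fin (n k)) (Fin (n k)) ℝ) ⊗ₖ leftInterface X k.castSucc)ᵀ
      * ((1 : Matrix (Fin (n k)) (Fin (n k)) ℝ) ⊗ₖ leftInterface X k.castSucc)
      * ((1 : Matrix (Fin (n k)) (Fin (n k)) ℝ) ⊗ₖ (leftGram X k.castSucc)⁻¹) = 1 := by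
  have h : leftGram X k.castSucc * (leftGram X k.castSucc)⁻¹ = 1 :=
    Matrix.mul_nonsing_inv _ (det_leftGram_ne_zero h0 hX _).isUnit
  rw [← Matrix.one_kronecker_transpose, ← Matrix.one_kronecker_mul, ← Matrix.one_kronecker_mul,
    ← leftGram, h, Matrix.one_kronecker_one]

theorem rightGram_inv_mul (hd : r (Fin.last d) = 1) {X : Cores n r} (hX : X ∈ totalSpace n r)
    (k : Fin d) : (rightGram X k.succ)⁻¹ * (rightGram X k.succ) = 1 :=
  Matrix.nonsing_inv_mul _ (det_rightGram_ne_zero hd hX _).isUnit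

/-- Riesz representation for the k-th summand of the metric: it explains the inverse Gram matrices
around every term of ζ. -/
theorem sum_phi_mul_represent (h0 : r 0 = 1) (hd : r (Fin.last d) = 1) {X : Cores n r}
    (hX : X ∈ totalSpace n r) (k : Fin d)
    (W : Matrix (Fin (n k) × Fin (r k.castSucc)) (Fin (r k.succ)) ℝ) (D : Core n r k) :
    ∑ i, phi (Function.update X k (leftFolding
        (((1 : Matrix (Fin (n k)) (Fin (n k)) ℝ) ⊗ₖ (leftGram X k.castSucc)⁻¹) * W
          * (rightGram X k.succ)⁻¹))) i * phi (Function.update X k D) i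
      = (Wᵀ * leftUnfolding D).trace := by
  rw [sum_mul_eq_trace k, unfolding_phi_update, unfolding_phi_update, leftUnfolding_leftFolding]
  exact trace_represent (kronecker_gram_mul_inv h0 hX k) (rightGram_inv_mul hd hX k) W _

/-- These are the normal equations: `compress` gives the core of the orthogonal projection of `T`
onto the tensors obtained by varying core k alone. -/
theorem sum_phi_compress (h0 : r 0 = 1) (hd : r (Fin.last d) = 1) {X : Cores n r}
    (hX : X ∈ totalSpace n r) (k : Fin d) (T : MultiIndex n → ℝ) (D : Core n r k) :
    ∑ i, phi (Function.update X k (leftFolding (compress X k T))) i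
        * phi (Function.update X k D) i = ∑ i, T i * phi (Function.update X k D) i := by
  have : compress X k T = ((1 : Matrix (Fin (n k)) (Fin (n k)) ℝ) ⊗ₖ (leftGram X k.castSucc)⁻¹)
      * (((1 : Matrix (Fin (n k)) (Fin (n k)) ℝ) ⊗ₖ leftInterface X k.castSucc)ᵀ
        * unfolding k T * rightInterface X k.succ) * (rightGram X k.succ)⁻¹ := by
    simp only [compress, Matrix.one_kronecker_mul, Matrix.one_kronecker_transpose,
      Matrix.mul_assoc]
  rw [this, sum_phi_mul_represent h0 hd hX, sum_mul_eq_trace k, unfolding_phi_update]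
  simp only [Matrix.transpose_mul, Matrix.transpose_transpose, Matrix.mul_assoc]
  rw [Matrix.trace_mul_comm]
  simp only [Matrix.mul_assoc]

/-- `S` and `T` share the right interface of `X`, so the factor `rightGram` they produce cancels its
inverse and only the left inverse remains in the formula. -/
theorem sum_phi_leftCorrection (h0 : r 0 = 1) (hd : r (Fin.last d) = 1) {X : Cores n r}
    (hX : X ∈ totalSpace n r) (k : Fin d)
    (P Q : Matrix (LeftIndex n k.castSucc) (Fin (r k.castSucc)) ℝ) (C D : Core n r k)
    {S T : MultiIndex n → ℝ}
    (hS : unfolding k S = ((1 : Matrix (Fin (n k)) (Fin (n k)) ℝ) ⊗ₖ Q) * leftUnfolding C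
      * (rightInterface X k.succ)ᵀ)
    (hT : unfolding k T = ((1 : Matrix (Fin (n k)) (Fin (n k)) ℝ) ⊗ₖ P) * leftUnfolding D
      * (rightInterface X k.succ)ᵀ) :
    ∑ i, phi (Function.update X k (leftFolding (leftCorrection X k P Q (leftUnfolding C)))) i
        * phi (Function.update X k D) i = ∑ i, S i * T i := by
  have : leftCorrection X k P Q (leftUnfolding C)
      = ((1 : Matrix (Fin (n k)) (Fin (n k)) ℝ) ⊗ₖ (leftGram X k.castSucc)⁻¹)
      * (((1 : Matrix (Fin (n k)) (Fin (n k)) ℝ) ⊗ₖ P)ᵀ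
        * (((1 : Matrix (Fin (n k)) (Fin (n k)) ℝ) ⊗ₖ Q) * leftUnfolding C
          * (rightInterface X k.succ)ᵀ) * rightInterface X k.succ) * (rightGram X k.succ)⁻¹ := by
    have hR : (rightInterface X k.succ)ᵀ * (rightInterface X k.succ * (rightGram X k.succ)⁻¹)
        = 1 := by
      rw [← Matrix.mul_assoc]
      exact Matrix.mul_nonsing_inv _ (det_rightGram_ne_zero hd hX _).isUnit
    simp only [leftCorrection, Matrix.one_kronecker_mul, Matrix.one_kronecker_transpose,
      Matrix.mul_assoc, hR, Matrix.mul_one]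
  rw [this, sum_phi_mul_represent h0 hd hX, sum_mul_eq_trace k, hS, hT]
  simp only [Matrix.transpose_mul, Matrix.transpose_transpose, Matrix.mul_assoc]
  rw [Matrix.trace_mul_comm]
  simp only [Matrix.mul_assoc]

/-- Here the left interface is shared, and it is the left Gram matrix that cancels. -/
theorem sum_phi_rightCorrection (h0 : r 0 = 1) (hd : r (Fin.last d) = 1) {X : Cores n r}
    (hX : X ∈ totalSpace n r) (k : Fin d)
    (P Q : Matrix (RightIndex n k.succ) (Fin (r k.succ)) ℝ) (C D : Core n r k)
    {S T : MultiIndex n → ℝ}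
    (hS : unfolding k S = ((1 : Matrix (Fin (n k)) (Fin (n k)) ℝ) ⊗ₖ leftInterface X k.castSucc)
      * leftUnfolding C * Pᵀ)
    (hT : unfolding k T = ((1 : Matrix (Fin (n k)) (Fin (n k)) ℝ) ⊗ₖ leftInterface X k.castSucc)
      * leftUnfolding D * Qᵀ) :
    ∑ i, phi (Function.update X k (leftFolding (rightCorrection X k (leftUnfolding C) P Q))) i
        * phi (Function.update X k D) i = ∑ i, S i * T i := by
  have : rightCorrection X k (leftUnfolding C) P Q
      = ((1 : Matrix (Fin (n k)) (Fin (n k)) ℝ) ⊗ₖ (leftGram X k.castSucc)⁻¹)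
      * (((1 : Matrix (Fin (n k)) (Fin (n k)) ℝ) ⊗ₖ leftInterface X k.castSucc)ᵀ
        * (((1 : Matrix (Fin (n k)) (Fin (n k)) ℝ) ⊗ₖ leftInterface X k.castSucc)
          * leftUnfolding C * Pᵀ) * Q) * (rightGram X k.succ)⁻¹ := by
    have hL := mul_eq_one_comm.1 (kronecker_gram_mul_inv h0 hX k)
    simp only [rightCorrection, ← Matrix.mul_assoc] at hL ⊢
    rw [hL, Matrix.one_mul]
  rw [this, sum_phi_mul_represent h0 hd hX, sum_mul_eq_trace k, hS, hT]
  simp only [Matrix.transpose_mul, Matrix.transpose_transpose, Matrix.mul_assoc]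
  rw [Matrix.trace_mul_comm]
  simp only [Matrix.mul_assoc]

/-! ### The preconditioned metric -/

theorem phi_update_add (X : Cores n r) (k : Fin d) (Y Z : Core n r k) :
    phi (Function.update X k (Y + Z))
      = phi (Function.update X k Y) + phi (Function.update X k Z) :=
  (phiMultilinear n r).map_update_add X k Y Z

theorem phi_update_smul (X : Cores n r) (k : Fin d) (c : ℝ) (Z : Core n r k) :
    phi (Function.update X k (c • Z)) = c • phi (Function.update X k Z) :=
  (phiMultilinear n r).map_update_smul X k c Z

theorem premetric_eq_sum_dotProduct (X ξ η : Cores n r) : premetric X ξ η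
    = ∑ k, phi (Function.update X k (ξ k)) ⬝ᵥ phi (Function.update X k (η k)) := rfl

theorem eq_zero_of_phi_update_eq_zero (h0 : r 0 = 1) (hd : r (Fin.last d) = 1) {X : Cores n r}
    (hX : X ∈ totalSpace n r) {k : Fin d} {Z : Core n r k}
    (h : phi (Function.update X k Z) = 0) : Z = 0 := by
  -- Representing the form ⟨Z, ·⟩ and evaluating it at Z gives |Z|², while the other side pairs with
  -- φ(…, Z, …) = 0.
  have key := sum_phi_mul_represent h0 hd hX k (leftUnfolding Z) Z
  simp only [h, Pi.zero_apply, mul_zero, Finset.sum_const_zero] at key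
  have hz : leftUnfolding Z = 0 := by
    refine Matrix.trace_conjTranspose_mul_self_eq_zero_iff.1 ?_
    rw [Matrix.conjTranspose_eq_transpose_of_trivial, ← key]
  funext a i b
  exact congrFun (congrFun hz (i, a)) b

theorem isRiemannianMetricOn_premetric (h0 : r 0 = 1) (hd : r (Fin.last d) = 1) :
    FlatRiemannian.IsRiemannianMetricOn (totalSpace n r) premetric where
  add_left X _ v v' w := by
    simp only [premetric_eq_sum_dotProduct, Pi.add_apply, phi_update_add, add_dotProduct,
      Finset.sum_add_distrib]
  smul_left X _ c v w := by
    simp only [premetric_eq_sum_dotProduct, Pi.smul_apply, phi_update_smul, smul_dotProduct,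
      smul_eq_mul, Finset.mul_sum]
  symm X _ v w := by
    simp only [premetric_eq_sum_dotProduct, dotProduct_comm]
  pos X hX v hv := by
    obtain ⟨k, hk⟩ := Function.ne_iff.1 hv
    rw [premetric_eq_sum_dotProduct]
    refine Finset.sum_pos' (fun j _ => Finset.sum_nonneg fun i _ => mul_self_nonneg _)
      ⟨k, Finset.mem_univ k, ?_⟩
    refine lt_of_le_of_ne (Finset.sum_nonneg fun i _ => mul_self_nonneg _) fun h => hk ?_
    exact eq_zero_of_phi_update_eq_zero h0 hd hX (dotProduct_self_eq_zero.1 h.symm)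
  smooth v w := (contDiff_premetric v w).contDiffOn

theorem fderiv_premetric (X u v w : Cores n r) :
    fderiv ℝ (fun Y => premetric Y v w) X u
      = ∑ k, (mixedSum X u v k ⬝ᵥ phi (Function.update X k (w k))
        + phi (Function.update X k (v k)) ⬝ᵥ mixedSum X u w k) := by
  have hphi : ∀ (z : Cores n r) k i,
      DifferentiableAt ℝ (fun Y : Cores n r => phi (Function.update Y k (z k)) i) X := fun z k i =>
    (((contDiff_phi i).comp (contDiff_update k (z k))).differentiable (by simp)).differentiableAt
  unfold premetric
  rw [fderiv_fun_sum fun k _ => DifferentiableAt.fun_sum fun i _ => (hphi v k i).fun_mul (hphi w k i),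
    sum_apply]
  refine Finset.sum_congr rfl fun k _ => ?_
  rw [fderiv_fun_sum fun i _ => (hphi v k i).fun_mul (hphi w k i), sum_apply]
  simp only [dotProduct, ← Finset.sum_add_distrib]
  refine Finset.sum_congr rfl fun i _ => ?_
  rw [fderiv_fun_mul (hphi v k i) (hphi w k i)]
  simp only [add_apply, smul_apply, smul_eq_mul, fderiv_phi_update]
  ring

/-! ### The Koszul formula -/

/-- The linear form `M ↦ ⟨φ(X¹, …, M, …, X^d), φ(X¹, …, D, …, X^d)⟩` on left unfolded cores. -/
def coreForm (X : Cores n r) (k : Fin d) (D : Core n r k) :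
    Matrix (Fin (n k) × Fin (r k.castSucc)) (Fin (r k.succ)) ℝ →ₗ[ℝ] ℝ where
  toFun M := phi (Function.update X k (leftFolding M)) ⬝ᵥ phi (Function.update X k D)
  map_add' M N := by
    rw [← add_dotProduct, ← phi_update_add]
    rfl
  map_smul' c M := by
    rw [RingHom.id_apply, ← smul_dotProduct, ← phi_update_smul]
    rfl

theorem sum_Iio_add_sum_Ioi (k : Fin d) (f : Fin d → ℝ) :
    ∑ j ∈ Finset.Iio k, f j + ∑ j ∈ Finset.Ioi k, f j
      = ∑ j ∈ Finset.univ.filter (fun j => j ≠ k), f j := by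
  rw [← Finset.sum_union (Finset.disjoint_left.2 fun j h h' =>
    (Finset.mem_Iio.1 h).not_gt (Finset.mem_Ioi.1 h'))]
  refine Finset.sum_congr (Finset.ext fun j => ?_) fun _ _ => rfl
  simp [lt_or_lt_iff_ne]

theorem unfolding_phi_update_update_of_lt {j k : Fin d} (h : j < k) (X ξ : Cores n r)
    (D : Core n r k) :
    unfolding k (phi (Function.update (Function.update X j (ξ j)) k D))
      = ((1 : Matrix (Fin (n k)) (Fin (n k)) ℝ) ⊗ₖ modLeft X ξ k.castSucc j)
      * leftUnfolding D * (rightInterface X k.succ)ᵀ := by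
  rw [unfolding_phi_update, rightInterface_update, modLeft]
  exact (Fin.castSucc_lt_castSucc_iff.2 h).trans k.castSucc_lt_succ

theorem unfolding_phi_update_update_of_gt {j k : Fin d} (h : k < j) (X ξ : Cores n r)
    (D : Core n r k) :
    unfolding k (phi (Function.update (Function.update X j (ξ j)) k D))
      = ((1 : Matrix (Fin (n k)) (Fin (n k)) ℝ) ⊗ₖ leftInterface X k.castSucc)
      * leftUnfolding D * (modRight X ξ k.succ j)ᵀ := by
  rw [unfolding_phi_update, leftInterface_update, modRight]
  exact Fin.castSucc_le_castSucc_iff.2 h.le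

theorem update_update_self_of_ne {j k : Fin d} (h : j ≠ k) (X ξ : Cores n r) :
    Function.update (Function.update X j (ξ j)) k (X k) = Function.update X j (ξ j) := by
  rw [Function.update_comm h, Function.update_eq_self]

/-- Each term of ζᵏ was built to represent one inner product. A modified core j lies in the left
interface if j < k and in the right one if j > k, so left and right corrections recombine into sums
over j ≠ k. -/
theorem coreForm_zetaUnfolded (h0 : r 0 = 1) (hd : r (Fin.last d) = 1) {X : Cores n r}
    (hX : X ∈ totalSpace n r) (ξ lam : Cores n r) (k : Fin d) (D : Core n r k) :
    coreForm X k D (zetaUnfolded X ξ lam k)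
      = mixedSum X ξ lam k ⬝ᵥ phi (Function.update X k D)
      + mixedSum X lam ξ k ⬝ᵥ phi (Function.update X k D)
      + ∑ j ∈ Finset.univ.filter (fun j => j ≠ k), phi (Function.update X k (lam k)) ⬝ᵥ
          phi (Function.update (Function.update X j (ξ j)) k D)
      + ∑ j ∈ Finset.univ.filter (fun j => j ≠ k), phi (Function.update X k (ξ k)) ⬝ᵥ
          phi (Function.update (Function.update X j (lam j)) k D)
      - ∑ j ∈ Finset.univ.filter (fun j => j ≠ k), phi (Function.update X j (ξ j)) ⬝ᵥ
          phi (Function.update (Function.update X j (lam j)) k D)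
      - ∑ j ∈ Finset.univ.filter (fun j => j ≠ k), phi (Function.update X j (lam j)) ⬝ᵥ
          phi (Function.update (Function.update X j (ξ j)) k D) := by
  have hc : ∀ T, coreForm X k D (compress X k T) = T ⬝ᵥ phi (Function.update X k D) := fun T =>
    sum_phi_compress h0 hd hX k T D
  have hl : ∀ u v : Cores n r, ∑ j ∈ Finset.Iio k, coreForm X k D (leftCorrection X k
      (modLeft X u k.castSucc j) (leftInterface X k.castSucc) (leftUnfolding (v k)))
      = ∑ j ∈ Finset.Iio k, phi (Function.update X k (v k)) ⬝ᵥ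
          phi (Function.update (Function.update X j (u j)) k D) := fun u v =>
    Finset.sum_congr rfl fun j hj => sum_phi_leftCorrection h0 hd hX k _ _ _ _
      (unfolding_phi_update X k (v k))
      (unfolding_phi_update_update_of_lt (Finset.mem_Iio.1 hj) X u D)
  have hr : ∀ u v : Cores n r, ∑ j ∈ Finset.Ioi k, coreForm X k D (rightCorrection X k
      (leftUnfolding (v k)) (rightInterface X k.succ) (modRight X u k.succ j))
      = ∑ j ∈ Finset.Ioi k, phi (Function.update X k (v k)) ⬝ᵥ
          phi (Function.update (Function.update X j (u j)) k D) := fun u v =>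
    Finset.sum_congr rfl fun j hj => sum_phi_rightCorrection h0 hd hX k _ _ _ _
      (unfolding_phi_update X k (v k))
      (unfolding_phi_update_update_of_gt (Finset.mem_Ioi.1 hj) X u D)
  have hl' : ∀ u v : Cores n r, ∑ j ∈ Finset.Iio k, coreForm X k D (leftCorrection X k
      (modLeft X u k.castSucc j) (modLeft X v k.castSucc j) (leftUnfolding (X k)))
      = ∑ j ∈ Finset.Iio k, phi (Function.update X j (v j)) ⬝ᵥ
          phi (Function.update (Function.update X j (u j)) k D) := fun u v =>
    Finset.sum_congr rfl fun j hj => sum_phi_leftCorrection h0 hd hX k _ _ _ _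
      -- φ(…, vʲ, …) is viewed as a tensor with cores j and k replaced, core k by `X k` itself.
      (by rw [← unfolding_phi_update_update_of_lt (Finset.mem_Iio.1 hj),
        update_update_self_of_ne (Finset.mem_Iio.1 hj).ne])
      (unfolding_phi_update_update_of_lt (Finset.mem_Iio.1 hj) X u D)
  have hr' : ∀ u v : Cores n r, ∑ j ∈ Finset.Ioi k, coreForm X k D (rightCorrection X k
      (leftUnfolding (X k)) (modRight X v k.succ j) (modRight X u k.succ j))
      = ∑ j ∈ Finset.Ioi k, phi (Function.update X j (v j)) ⬝ᵥ
          phi (Function.update (Function.update X j (u j)) k D) := fun u v =>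
    Finset.sum_congr rfl fun j hj => sum_phi_rightCorrection h0 hd hX k _ _ _ _
      (by rw [← unfolding_phi_update_update_of_gt (Finset.mem_Ioi.1 hj),
        update_update_self_of_ne (Finset.mem_Ioi.1 hj).ne'])
      (unfolding_phi_update_update_of_gt (Finset.mem_Ioi.1 hj) X u D)
  simp only [zetaUnfolded, map_add, map_sub, map_sum, hc, hl, hr, hl', hr',
    ← sum_Iio_add_sum_Ioi]
  ring

theorem premetric_zeta (h0 : r 0 = 1) (hd : r (Fin.last d) = 1) {X : Cores n r}
    (hX : X ∈ totalSpace n r) (ξ lam η : Cores n r) :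
    premetric X (zeta X ξ lam) η = fderiv ℝ (fun Y => premetric Y lam η) X ξ
      + fderiv ℝ (fun Y => premetric Y ξ η) X lam - fderiv ℝ (fun Y => premetric Y ξ lam) X η := by
  -- The terms of ∂_η g(ξ, λ) collect the directions ηʲ with j ≠ k at core k. Exchanging j and k
  -- regroups them by the core that η occupies, which is how they enter ζ.
  have swap : ∀ u v : Cores n r, ∑ k, ∑ j ∈ Finset.univ.filter (fun j => j ≠ k),
      phi (Function.update X j (u j)) ⬝ᵥ
        phi (Function.update (Function.update X j (v j)) k (η k))
      = ∑ k, phi (Function.update X k (u k)) ⬝ᵥ mixedSum X η v k := by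
    intro u v
    simp only [mixedSum, dotProduct_sum, Finset.sum_filter]
    rw [Finset.sum_comm]
    refine Finset.sum_congr rfl fun j _ => Finset.sum_congr rfl fun k _ => ?_
    by_cases h : j = k
    · simp [h]
    · rw [if_pos h, if_pos (Ne.symm h), Function.update_comm h]
  have h : premetric X (zeta X ξ lam) η = ∑ k, coreForm X k (η k) (zetaUnfolded X ξ lam k) := rfl
  simp only [h, coreForm_zetaUnfolded h0 hd hX, Finset.sum_add_distrib, Finset.sum_sub_distrib,
    swap, fderiv_premetric]
  have fold : ∀ u v k, ∑ j ∈ Finset.univ.filter (fun j => j ≠ k),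
      phi (Function.update (Function.update X j (u j)) k (v k)) = mixedSum X u v k :=
    fun _ _ _ => rfl
  simp only [← dotProduct_sum, fold, dotProduct_comm (mixedSum X η ξ _)]
  ring

end TensorTrain

/-! ### Smooth matrix-valued maps -/

/-- All entries of the matrix-valued map `F` are smooth on `U`. -/
def SmoothEntriesOn {E ι κ : Type*} [NormedAddCommGroup E] [NormedSpace ℝ E]
    (F : E → Matrix ι κ ℝ) (U : Set E) : Prop :=
  ∀ i j, ContDiffOn ℝ ∞ (fun x => F x i j) U

namespace SmoothEntriesOn

variable {E ι κ μ ν : Type*} [NormedAddCommGroup E] [NormedSpace ℝ E] {U : Set E}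

theorem const (A : Matrix ι κ ℝ) : SmoothEntriesOn (fun _ : E => A) U :=
  fun _ _ => contDiffOn_const

theorem transpose {F : E → Matrix ι κ ℝ} (hF : SmoothEntriesOn F U) :
    SmoothEntriesOn (fun x => (F x)ᵀ) U :=
  fun i j => hF j i

theorem add {F G : E → Matrix ι κ ℝ} (hF : SmoothEntriesOn F U) (hG : SmoothEntriesOn G U) :
    SmoothEntriesOn (fun x => F x + G x) U :=
  fun i j => (hF i j).add (hG i j)

theorem sub {F G : E → Matrix ι κ ℝ} (hF : SmoothEntriesOn F U) (hG : SmoothEntriesOn G U) :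
    SmoothEntriesOn (fun x => F x - G x) U :=
  fun i j => (hF i j).sub (hG i j)

theorem sum {α : Type*} {s : Finset α} {F : α → E → Matrix ι κ ℝ}
    (hF : ∀ a ∈ s, SmoothEntriesOn (F a) U) : SmoothEntriesOn (fun x => ∑ a ∈ s, F a x) U :=
  fun i j => by
    simp only [Matrix.sum_apply]
    exact ContDiffOn.sum fun a ha => hF a ha i j

theorem mul [Fintype κ] {F : E → Matrix ι κ ℝ} {G : E → Matrix κ μ ℝ}
    (hF : SmoothEntriesOn F U) (hG : SmoothEntriesOn G U) :
    SmoothEntriesOn (fun x => F x * G x) U :=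
  fun i j => by
    simp only [Matrix.mul_apply]
    exact ContDiffOn.sum fun a _ => (hF i a).mul (hG a j)

theorem kronecker {F : E → Matrix ι κ ℝ} {G : E → Matrix μ ν ℝ} (hF : SmoothEntriesOn F U)
    (hG : SmoothEntriesOn G U) : SmoothEntriesOn (fun x => F x ⊗ₖ G x) U :=
  fun i j => (hF i.1 j.1).mul (hG i.2 j.2)

theorem det [Fintype κ] [DecidableEq κ] {F : E → Matrix κ κ ℝ} (hF : SmoothEntriesOn F U) :
    ContDiffOn ℝ ∞ (fun x => (F x).det) U := by
  simp only [Matrix.det_apply']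
  exact ContDiffOn.sum fun σ _ => contDiffOn_const.mul (contDiffOn_prod fun i _ => hF _ _)

/-- An entry of the adjugate is the determinant of the matrix with row `j` replaced by a constant
row. -/
theorem adjugate [Fintype κ] [DecidableEq κ] {F : E → Matrix κ κ ℝ} (hF : SmoothEntriesOn F U) :
    SmoothEntriesOn (fun x => (F x).adjugate) U := by
  intro i j
  simp only [Matrix.adjugate_apply]
  refine det fun a b => ?_
  by_cases h : a = j
  · subst h
    simpa using contDiffOn_const
  · simpa [Matrix.updateRow_ne h] using hF a b

theorem inv [Fintype κ] [DecidableEq κ] {F : E → Matrix κ κ ℝ} (hF : SmoothEntriesOn F U)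
    (h : ∀ x ∈ U, (F x).det ≠ 0) : SmoothEntriesOn (fun x => (F x)⁻¹) U := by
  intro i j
  simp only [Matrix.inv_def, Ring.inverse_eq_inv', Matrix.smul_apply, smul_eq_mul]
  exact (hF.det.inv h).mul (hF.adjugate i j)

end SmoothEntriesOn

/-! ### Smoothness of ζ and the connection of the preconditioned metric -/

namespace TensorTrain

variable {d : ℕ} {n : Fin d → ℕ} {r : Fin (d + 1) → ℕ}

theorem smooth_leftInterface (m : Fin (d + 1)) (U : Set (Cores n r)) :
    SmoothEntriesOn (fun X : Cores n r => leftInterface X m) U :=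
  fun i b => (contDiff_leftInterface m i b).contDiffOn

theorem smooth_rightInterface (m : Fin (d + 1)) (U : Set (Cores n r)) :
    SmoothEntriesOn (fun X : Cores n r => rightInterface X m) U :=
  fun i b => (contDiff_rightInterface m i b).contDiffOn

theorem smooth_modLeft (ξ : Cores n r) (m : Fin (d + 1)) (j : Fin d) (U : Set (Cores n r)) :
    SmoothEntriesOn (fun X : Cores n r => modLeft X ξ m j) U :=
  fun i b => ((contDiff_leftInterface m i b).comp (contDiff_update j (ξ j))).contDiffOn

theorem smooth_modRight (ξ : Cores n r) (m : Fin (d + 1)) (j : Fin d) (U : Set (Cores n r)) :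
    SmoothEntriesOn (fun X : Cores n r => modRight X ξ m j) U :=
  fun i b => ((contDiff_rightInterface m i b).comp (contDiff_update j (ξ j))).contDiffOn

theorem smooth_leftUnfolding (k : Fin d) (U : Set (Cores n r)) :
    SmoothEntriesOn (fun X : Cores n r => leftUnfolding (X k)) U :=
  fun p b => (contDiff_entry k p.2 p.1 b).contDiffOn

theorem smooth_unfolding_mixedSum (ξ lam : Cores n r) (k : Fin d) (U : Set (Cores n r)) :
    SmoothEntriesOn (fun X : Cores n r => unfolding k (mixedSum X ξ lam k)) U := by
  intro p q
  simp only [unfolding, mixedSum, Matrix.of_apply, Finset.sum_apply]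
  exact ContDiffOn.sum fun j _ => ((contDiff_phi _).comp
    ((contDiff_update k (lam k)).comp (contDiff_update j (ξ j)))).contDiffOn

theorem smooth_leftGram_inv (h0 : r 0 = 1) (m : Fin (d + 1)) :
    SmoothEntriesOn (fun X : Cores n r => (leftGram X m)⁻¹) (totalSpace n r) :=
  ((smooth_leftInterface m _).transpose.mul (smooth_leftInterface m _)).inv
    fun _ hX => det_leftGram_ne_zero h0 hX m

theorem smooth_rightGram_inv (hd : r (Fin.last d) = 1) (m : Fin (d + 1)) :
    SmoothEntriesOn (fun X : Cores n r => (rightGram X m)⁻¹) (totalSpace n r) :=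
  ((smooth_rightInterface m _).transpose.mul (smooth_rightInterface m _)).inv
    fun _ hX => det_rightGram_ne_zero hd hX m

theorem smooth_compress_mixedSum (h0 : r 0 = 1) (hd : r (Fin.last d) = 1) (ξ lam : Cores n r)
    (k : Fin d) : SmoothEntriesOn (fun X : Cores n r => compress X k (mixedSum X ξ lam k))
      (totalSpace n r) :=
  (((SmoothEntriesOn.const 1).kronecker
    ((smooth_leftGram_inv h0 _).mul (smooth_leftInterface _ _).transpose)).mul
      (smooth_unfolding_mixedSum ξ lam k _)).mul
    ((smooth_rightInterface _ _).mul (smooth_rightGram_inv hd _))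

theorem smooth_leftCorrection (h0 : r 0 = 1) {k : Fin d}
    {P Q : Cores n r → Matrix (LeftIndex n k.castSucc) (Fin (r k.castSucc)) ℝ}
    {C : Cores n r → Matrix (Fin (n k) × Fin (r k.castSucc)) (Fin (r k.succ)) ℝ}
    (hP : SmoothEntriesOn P (totalSpace n r)) (hQ : SmoothEntriesOn Q (totalSpace n r))
    (hC : SmoothEntriesOn C (totalSpace n r)) :
    SmoothEntriesOn (fun X => leftCorrection X k (P X) (Q X) (C X)) (totalSpace n r) :=
  ((SmoothEntriesOn.const 1).kronecker
    (((smooth_leftGram_inv h0 _).mul hP.transpose).mul hQ)).mul hC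

theorem smooth_rightCorrection (hd : r (Fin.last d) = 1) {k : Fin d}
    {C : Cores n r → Matrix (Fin (n k) × Fin (r k.castSucc)) (Fin (r k.succ)) ℝ}
    {P Q : Cores n r → Matrix (RightIndex n k.succ) (Fin (r k.succ)) ℝ}
    (hC : SmoothEntriesOn C (totalSpace n r)) (hP : SmoothEntriesOn P (totalSpace n r))
    (hQ : SmoothEntriesOn Q (totalSpace n r)) :
    SmoothEntriesOn (fun X => rightCorrection X k (C X) (P X) (Q X)) (totalSpace n r) :=
  ((hC.mul hP.transpose).mul hQ).mul (smooth_rightGram_inv hd _)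

theorem smooth_zetaUnfolded (h0 : r 0 = 1) (hd : r (Fin.last d) = 1) (ξ lam : Cores n r)
    (k : Fin d) :
    SmoothEntriesOn (fun X : Cores n r => zetaUnfolded X ξ lam k) (totalSpace n r) := by
  have hl := fun u v : Cores n r => SmoothEntriesOn.sum (s := Finset.Iio k) fun j _ =>
    smooth_leftCorrection h0 (smooth_modLeft u _ j _) (smooth_leftInterface k.castSucc _)
      (SmoothEntriesOn.const (leftUnfolding (v k)))
  have hr := fun u v : Cores n r => SmoothEntriesOn.sum (s := Finset.Ioi k) fun j _ =>
    smooth_rightCorrection hd (SmoothEntriesOn.const (leftUnfolding (v k)))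
      (smooth_rightInterface k.succ _) (smooth_modRight u _ j _)
  have hl' := fun u v : Cores n r => SmoothEntriesOn.sum (s := Finset.Iio k) fun j _ =>
    smooth_leftCorrection h0 (smooth_modLeft u _ j _) (smooth_modLeft v _ j _)
      (smooth_leftUnfolding k _)
  have hr' := fun u v : Cores n r => SmoothEntriesOn.sum (s := Finset.Ioi k) fun j _ =>
    smooth_rightCorrection hd (smooth_leftUnfolding k _) (smooth_modRight u _ j _)
      (smooth_modRight v _ j _)
  -- The nesting of sums and differences follows `zetaUnfolded` term by term, so the two sides agree
  -- by unfolding.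
  exact (((((((((smooth_compress_mixedSum h0 hd ξ lam k).add
    (smooth_compress_mixedSum h0 hd lam ξ k)).add (hl ξ lam)).add (hr ξ lam)).add
    (hl lam ξ)).add (hr lam ξ)).sub (hl' lam ξ)).sub (hr' lam ξ)).sub (hl' ξ lam)).sub (hr' ξ lam)

theorem contDiffOn_zeta (h0 : r 0 = 1) (hd : r (Fin.last d) = 1) (ξ lam : Cores n r) :
    ContDiffOn ℝ ∞ (fun X : Cores n r => zeta X ξ lam) (totalSpace n r) :=
  contDiffOn_pi.2 fun k => contDiffOn_pi.2 fun a => contDiffOn_pi.2 fun i =>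
    contDiffOn_pi.2 fun b => smooth_zetaUnfolded h0 hd ξ lam k (i, a) b

theorem exists_leviCivita_zeta (h0 : r 0 = 1) (hd : r (Fin.last d) = 1) :
    ∃ cov : (Cores n r → Cores n r) → Cores n r → (Cores n r →L[ℝ] Cores n r),
      FlatRiemannian.IsLeviCivitaOn (totalSpace n r) premetric cov ∧
      ∀ Y : Cores n r → Cores n r, ∀ X ∈ totalSpace n r, ∀ ξ,
        cov Y X ξ = fderiv ℝ Y X ξ + (1 / 2 : ℝ) • zeta X ξ (Y X) := by
  have hg := isRiemannianMetricOn_premetric (n := n) h0 hd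
  refine hg.exists_leviCivita isOpen_totalSpace (fun X ξ lam => (1 / 2 : ℝ) • zeta X ξ lam) ?_ ?_
  · intro X hX u v w
    rw [hg.smul_left X hX, ← premetric_zeta h0 hd hX]
    ring
  · exact fun u v => (contDiffOn_zeta h0 hd u v).const_smul (1 / 2 : ℝ)

end TensorTrain

end

theorem mainTheorem7 (d : ℕ) (n : Fin d → ℕ) (r : Fin (d + 1) → ℕ)
    (hr_zero : r 0 = 1) (hr_last : r (Fin.last d) = 1) :
    -- the total space is open, and the preconditioned metric is a Riemannian metric on it
    IsOpen (TensorTrain.totalSpace n r) ∧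
    FlatRiemannian.IsRiemannianMetricOn (TensorTrain.totalSpace n r) TensorTrain.premetric ∧
    -- its Levi-Civita connection exists and is given by the closed formula
    (∃ cov : (TensorTrain.Cores n r → TensorTrain.Cores n r) → TensorTrain.Cores n r →
        (TensorTrain.Cores n r →L[ℝ] TensorTrain.Cores n r),
      FlatRiemannian.IsLeviCivitaOn (TensorTrain.totalSpace n r) TensorTrain.premetric cov) ∧
    ∀ cov : (TensorTrain.Cores n r → TensorTrain.Cores n r) → TensorTrain.Cores n r →
        (TensorTrain.Cores n r →L[ℝ] TensorTrain.Cores n r),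
      FlatRiemannian.IsLeviCivitaOn (TensorTrain.totalSpace n r) TensorTrain.premetric cov →
      ∀ (lam : TensorTrain.Cores n r → TensorTrain.Cores n r),
      ∀ X ∈ TensorTrain.totalSpace n r, DifferentiableAt ℝ lam X →
      ∀ ξ : TensorTrain.Cores n r,
        cov lam X ξ = fderiv ℝ lam X ξ + (1 / 2 : ℝ) • TensorTrain.zeta X ξ (lam X) := by
  have hg := TensorTrain.isRiemannianMetricOn_premetric (n := n) hr_zero hr_last
  obtain ⟨cov₀, hcov₀, hformula⟩ := TensorTrain.exists_leviCivita_zeta (n := n) hr_zero hr_last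
  refine ⟨TensorTrain.isOpen_totalSpace, hg, ⟨cov₀, hcov₀⟩, ?_⟩
  intro cov hcov lam X hX hlam ξ
  -- Uniqueness holds pointwise, so differentiability of `lam` at the single point `X` is enough.
  rw [hcov.unique hg hcov₀ hX hlam, hformula lam X hX ξ]
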